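/- Let $n\in\mathbb N$, $0<p\le 1$, $\mathbb{T}^n=\mathbb{R}^n/\mathbb{Z}^n$, and write $f^{\mathrm{ext}}$ for the $1$-periodic extension to $\mathbb{R}^n$ of a (real- or complex-valued) function $f$ on $\mathbb{T}^n$. For $\Psi\in\mathcal{S}(\mathbb{R}^n)$ and $\zeta>0$ put $\Psi_\zeta(x)=\zeta^{-n}\Psi(x/\zeta)$, $m_\Psi f=\sup_{0<\zeta<\infty}|\Psi_\zeta*f^{\mathrm{ext}}|$ (convolution on $\mathbb{R}^n$; a periodic function) and $\|f\|_{\mathcal{H}^p}=\|m_\Psi f\|_{L^p(\mathbb{T}^n)}$; when $\int_{\mathbb{R}^n}\Psi\ne 0$ this is the quasinorm of the Hardy space $\mathcal{H}^p(\mathbb{T}^n)$. A ball $B(\bar x,\varepsilon)\subset\mathbb{R}^n$ with $\varepsilon<\frac12$ is called a representative ball of $f$ if $f$ vanishes almost everywhere outside the image of the ball in $\mathbb{T}^n$ and, among the points of $\bar x+\mathbb{Z}^n$, $\bar x$ is closest to $0$ and, among the closest ones, has the largest number of nonnegative coordinates (that is, $\bar x\in(-\frac12,\frac12]^n$). Proposition.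 Let $\Psi\in\mathcal{S}(\mathbb{R}^n)$ be arbitrary and $N=\lfloor n(\frac1p-1)\rfloor$. There is a constant $C$, depending only on $p$, $n$ and the fixed function $\Psi$, such that for every $f\in L^\infty(\mathbb{T}^n)$ and every representative ball $\bar B_f=B(\bar x,\varepsilon)$ of $f$ with $0<\varepsilon<\frac12$, $$\|f\|_{\mathcal{H}^p}^p\le C\Big(\varepsilon^n\|f\|_{L^\infty}^p+|\log\varepsilon|\max_{|\alpha|\le N}\Big|\int_{\bar B_f}x^\alpha f^{\mathrm{ext}}(x)\,dx\Big|^p\Big),$$ where $\alpha$ ranges over multiindices in $\mathbb{N}^n$. In particular the left-hand side is finite. -/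

import Mathlib

open MeasureTheory
open scoped ENNReal NNReal

noncomputable section

namespace TorusHardy

variable {n : ℕ} {𝕜 : Type*} [RCLike 𝕜]

/-- The quotient map `ℝⁿ → 𝕋ⁿ = ℝⁿ / ℤⁿ`, where `ℝⁿ` carries the Euclidean norm. -/
def toTorus (x : EuclideanSpace ℝ (Fin n)) : UnitAddTorus (Fin n) :=
  fun i => (x i : UnitAddCircle)

/-- The periodic extension `f^ext : ℝⁿ → 𝕜` of a function `f` on the torus. -/
def periodicExt (f : UnitAddTorus (Fin n) → 𝕜) : EuclideanSpace ℝ (Fin n) → 𝕜 :=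
  fun x => f (toTorus x)

/-- The rescaled function `Ψ_ζ(y) = ζ⁻ⁿ Ψ(y / ζ)`. -/
def dilate (Ψ : EuclideanSpace ℝ (Fin n) → 𝕜) (ζ : ℝ) : EuclideanSpace ℝ (Fin n) → 𝕜 :=
  fun y => (ζ ^ n)⁻¹ • Ψ (ζ⁻¹ • y)

/-- The convolution on `ℝⁿ` of a function `Φ` on `ℝⁿ` with the periodic extension of `f`, regarded
as a function on the torus. That this is `Φ * f^ext` is `conv_toTorus`. -/
def conv (Φ : EuclideanSpace ℝ (Fin n) → 𝕜) (f : UnitAddTorus (Fin n) → 𝕜)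
    (x : UnitAddTorus (Fin n)) : 𝕜 :=
  ∫ y : EuclideanSpace ℝ (Fin n), Φ y * f (x - toTorus y)

theorem conv_toTorus (Φ : EuclideanSpace ℝ (Fin n) → 𝕜) (f : UnitAddTorus (Fin n) → 𝕜)
    (x : EuclideanSpace ℝ (Fin n)) :
    conv Φ f (toTorus x) =
      convolution Φ (periodicExt f) (ContinuousLinearMap.mul ℝ 𝕜) volume x := by
  have h : ∀ y, toTorus (x - y) = toTorus x - toTorus y := fun y => by
    funext i; simp [toTorus]
  simp [conv, convolution, periodicExt, h]

/-- The maximal function `m_Ψ f(x) = sup_{0 < ζ < ∞} |(f * Ψ_ζ)(x)|`, with values in `[0, ∞]`. -/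
def maximalFunction (Ψ : SchwartzMap (EuclideanSpace ℝ (Fin n)) 𝕜)
    (f : UnitAddTorus (Fin n) → 𝕜) (x : UnitAddTorus (Fin n)) : ℝ≥0∞ :=
  ⨆ (ζ : ℝ) (_ : 0 < ζ), ‖conv (dilate Ψ ζ) f x‖ₑ

/-- The Hardy quasinorm `‖f‖_{𝓗^p} = ‖m_Ψ f‖_{L^p(𝕋ⁿ)}` of a function `f` on the torus, with values
in `[0, ∞]`; it is finite exactly when `m_Ψ f` has finite `L^p` quasinorm. -/
def hardyNorm (p : ℝ) (Ψ : SchwartzMap (EuclideanSpace ℝ (Fin n)) 𝕜)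
    (f : UnitAddTorus (Fin n) → 𝕜) : ℝ≥0∞ :=
  eLpNorm (maximalFunction Ψ f) (ENNReal.ofReal p) volume

/-- The integer vector `k ∈ ℤⁿ` as a point of `ℝⁿ`. -/
def latticeVec (k : Fin n → ℤ) : EuclideanSpace ℝ (Fin n) :=
  WithLp.toLp 2 fun i => (k i : ℝ)

/-- The Euclidean ball with center `c` and radius `r` in `ℝⁿ` is a representative ball of `f`:
`f` is supported (almost everywhere) on the image of the ball in the torus, and among all the
translates of the ball by integer vectors, which have the same image, this one has its center
closest to the origin and, if that leaves several candidates, with the largest number of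
nonnegative coordinates. Thus `c i ∈ (-1/2, 1/2]` for all `i`. -/
structure IsRepresentativeBall (f : UnitAddTorus (Fin n) → 𝕜)
    (c : EuclideanSpace ℝ (Fin n)) (r : ℝ) : Prop where
  ae_eq_zero : ∀ᵐ x : UnitAddTorus (Fin n), x ∉ toTorus '' Metric.closedBall c r → f x = 0
  norm_le : ∀ k : Fin n → ℤ, ‖c‖ ≤ ‖c + latticeVec k‖
  ncard_le : ∀ k : Fin n → ℤ, ‖c + latticeVec k‖ = ‖c‖ →
    {i | 0 ≤ (c + latticeVec k) i}.ncard ≤ {i | 0 ≤ c i}.ncard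

/-- The moment `∫_{B(c, r)} x^α f^ext(x) dx` for a multiindex `α`. -/
def moment (f : UnitAddTorus (Fin n) → 𝕜) (c : EuclideanSpace ℝ (Fin n)) (r : ℝ)
    (α : Fin n → ℕ) : 𝕜 :=
  ∫ x in Metric.closedBall c r, ((∏ i, x i ^ α i : ℝ) : 𝕜) * periodicExt f x

end TorusHardy

end

noncomputable section

namespace TorusHardy

variable {n : ℕ} {𝕜 : Type*} [RCLike 𝕜]

/-! ### The covering map -/

/-! Integrate the p-th power of the maximal function over the unit cube centered at `c`, split at
distance `2 * ε` from `c`. Near `c`, `maximalFunction_le` bounds it by ‖Ψ‖₁ ‖f‖_∞ and the ball has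
volume of order εⁿ.

Far from `c`, put z = x - c. The periodic extension lives on disjoint balls around the points c + k,
and all copies have the same moments after translation (`enorm_conv_dilate_le_tsum`). Expanding Ψ_ζ
to order N at z - k, the Taylor polynomial produces moments of f and the remainder gains ε^(N+1),
plus εⁿ from the volume of the ball (`exists_enorm_integral_ball_le`). A derivative of order j of
Ψ_ζ is dominated by `decay (n + j) ζ`, whose lattice sum is O(‖z‖^(-(n+j))) uniformly in ζ
(`exists_tsum_decay_le_inv_norm_pow`). With M bounding the moments, this gives m_Ψ f ≲ ‖z‖^(-(n+N))
M + ‖z‖^(-(n+N+1)) ε^(n+N+1) ‖f‖_∞.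

The choice of N means (n+N)p ≤ n < (n+N+1)p. After taking p-th powers, the first term is at worst
the critical power ‖z‖⁻ⁿ, whose integral over 2ε ≤ ‖z‖ ≤ n costs |log ε|; the second is integrable
at infinity and scales to εⁿ ‖f‖_∞^p (`exists_lintegral_majorant_le`). -/

theorem toTorus_sub (x y : EuclideanSpace ℝ (Fin n)) :
    toTorus (x - y) = toTorus x - toTorus y := by
  funext i; simp [toTorus]

theorem toTorus_add_latticeVec (x : EuclideanSpace ℝ (Fin n)) (k : Fin n → ℤ) :
    toTorus (x + latticeVec k) = toTorus x := by
  funext i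
  simp [toTorus, latticeVec]

theorem exists_eq_add_latticeVec_of_toTorus_eq {x y : EuclideanSpace ℝ (Fin n)}
    (h : toTorus x = toTorus y) : ∃ k : Fin n → ℤ, x = y + latticeVec k := by
  have h1 : ∀ i, ∃ m : ℤ, m • (1 : ℝ) = x i - y i := fun i => by
    rw [← AddCircle.coe_eq_zero_iff]
    have := congrFun h i
    simp only [toTorus] at this
    simp [this]
  choose k hk using h1
  refine ⟨k, ?_⟩
  ext i
  have := hk i
  simp [latticeVec] at this ⊢
  linarith

theorem preimage_toTorus_image (s : Set (EuclideanSpace ℝ (Fin n))) :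
    toTorus ⁻¹' (toTorus '' s) = ⋃ k : Fin n → ℤ, (· + latticeVec k) '' s := by
  ext x
  simp only [Set.mem_preimage, Set.mem_image, Set.mem_iUnion]
  constructor
  · rintro ⟨y, hy, hxy⟩
    obtain ⟨k, hk⟩ := exists_eq_add_latticeVec_of_toTorus_eq hxy.symm
    exact ⟨k, y, hy, hk.symm⟩
  · rintro ⟨k, y, hy, rfl⟩
    exact ⟨y, hy, (toTorus_add_latticeVec y k).symm⟩

theorem measurable_toTorus : Measurable (toTorus (n := n)) := by
  refine measurable_pi_lambda _ fun i => ?_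
  exact AddCircle.measurable_mk'.comp (by fun_prop)

/-- The half-open unit cube with corner `a`. -/
def cube (a : EuclideanSpace ℝ (Fin n)) : Set (EuclideanSpace ℝ (Fin n)) :=
  {x | ∀ i, x i ∈ Set.Ioc (a i) (a i + 1)}

/-- The corner is left free so that the final integral can run over the cube centered at `c`. -/
theorem measurePreserving_toTorus (a : EuclideanSpace ℝ (Fin n)) :
    MeasurePreserving toTorus (volume.restrict (cube a)) volume := by
  have h1 : MeasurePreserving (fun (x : Fin n → ℝ) i => (x i : UnitAddCircle))
      (volume.restrict (Set.univ.pi fun i => Set.Ioc (a i) (a i + 1))) volume := by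
    rw [volume_pi, Measure.restrict_pi_pi]
    exact measurePreserving_pi _ _ fun i => UnitAddCircle.measurePreserving_mk (a i)
  have h2 := (PiLp.volume_preserving_ofLp (Fin n)).restrict_preimage
    (s := Set.univ.pi fun i => Set.Ioc (a i) (a i + 1))
    (MeasurableSet.univ_pi fun i => measurableSet_Ioc)
  have h3 := h1.comp h2
  convert! h3 using 2
  ext x
  simp [cube]

theorem iUnion_cube (a : EuclideanSpace ℝ (Fin n)) :
    ⋃ k : Fin n → ℤ, cube (a + latticeVec k) = Set.univ := by
  refine Set.eq_univ_of_forall fun x => Set.mem_iUnion.2 ⟨fun i => ⌈x i - a i⌉ - 1, fun i => ?_⟩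
  have h1 := Int.le_ceil (x i - a i)
  have h2 := Int.ceil_lt_add_one (x i - a i)
  simp only [latticeVec, PiLp.add_apply, Int.cast_sub, Int.cast_one, Set.mem_Ioc]
  constructor <;> linarith

theorem quasiMeasurePreserving_toTorus :
    Measure.QuasiMeasurePreserving (toTorus (n := n)) volume volume := by
  refine ⟨measurable_toTorus, ?_⟩
  refine Measure.AbsolutelyContinuous.mk fun s hs h0 => ?_
  rw [Measure.map_apply measurable_toTorus hs]
  have h : toTorus ⁻¹' s = ⋃ k : Fin n → ℤ, toTorus ⁻¹' s ∩ cube (0 + latticeVec k) := by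
    rw [← Set.inter_iUnion, iUnion_cube, Set.inter_univ]
  rw [h]
  refine measure_iUnion_null fun k => ?_
  have h2 := (measurePreserving_toTorus (0 + latticeVec k)).measure_preimage hs.nullMeasurableSet
  rwa [Measure.restrict_apply (measurable_toTorus hs), h0] at h2

theorem aestronglyMeasurable_periodicExt {f : UnitAddTorus (Fin n) → 𝕜}
    (hf : AEStronglyMeasurable f volume) : AEStronglyMeasurable (periodicExt f) volume :=
  hf.comp_quasiMeasurePreserving quasiMeasurePreserving_toTorus

theorem ae_enorm_periodicExt_le (f : UnitAddTorus (Fin n) → 𝕜) :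
    ∀ᵐ x, ‖periodicExt f x‖ₑ ≤ eLpNorm f ∞ volume := by
  rw [eLpNorm_exponent_top]
  exact quasiMeasurePreserving_toTorus.ae (enorm_ae_le_eLpNormEssSup f volume)

/-- The integral of any function on the torus is bounded by the integral of its lift over a unit
cube. -/
theorem lintegral_torus_le (g : UnitAddTorus (Fin n) → ℝ≥0∞) (a : EuclideanSpace ℝ (Fin n)) :
    ∫⁻ x, g x ≤ ∫⁻ x in cube a, g (toTorus x) := by
  rw [← (measurePreserving_toTorus a).map_eq]
  -- This inequality needs no measurability of `g`, so measurability of the maximal function is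
  -- never an issue.
  exact lintegral_map_le _ _

/-! ### Lattice geometry -/

@[simp] theorem latticeVec_apply (k : Fin n → ℤ) (i : Fin n) : latticeVec k i = k i := rfl

theorem latticeVec_sub (k l : Fin n → ℤ) : latticeVec (k - l) = latticeVec k - latticeVec l := by
  ext i; simp

theorem abs_apply_le_norm (x : EuclideanSpace ℝ (Fin n)) (i : Fin n) : |x i| ≤ ‖x‖ := by
  simpa using PiLp.norm_apply_le x i

theorem one_le_abs_intCast {m : ℤ} (hm : m ≠ 0) : (1 : ℝ) ≤ |(m : ℝ)| := by
  rw [← Int.cast_abs]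
  exact_mod_cast Int.one_le_abs hm

theorem one_le_norm_latticeVec {k : Fin n → ℤ} (hk : k ≠ 0) : 1 ≤ ‖latticeVec k‖ := by
  obtain ⟨i, hi⟩ := Function.ne_iff.1 hk
  refine le_trans ?_ (abs_apply_le_norm _ i)
  rw [latticeVec_apply]
  exact one_le_abs_intCast hi

theorem pairwise_disjoint_closedBall_latticeVec (c : EuclideanSpace ℝ (Fin n)) {r : ℝ}
    (hr : r < 1 / 2) :
    Pairwise (Function.onFun Disjoint
      fun k : Fin n → ℤ => Metric.closedBall (c + latticeVec k) r) := by
  intro k l hkl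
  refine Metric.closedBall_disjoint_closedBall ?_
  rw [dist_add_left, dist_eq_norm, ← latticeVec_sub]
  have := one_le_norm_latticeVec (sub_ne_zero.2 hkl)
  linarith

/-- Holds coordinate by coordinate. It makes a point far from the ball at `c` equally far from every
translated copy, so the Taylor estimate applies to all of them. -/
theorem norm_le_norm_sub_latticeVec {z : EuclideanSpace ℝ (Fin n)} (hz : ∀ i, |z i| ≤ 1 / 2)
    (k : Fin n → ℤ) : ‖z‖ ≤ ‖z - latticeVec k‖ := by
  rw [EuclideanSpace.norm_eq, EuclideanSpace.norm_eq]
  refine Real.sqrt_le_sqrt (Finset.sum_le_sum fun i _ => ?_)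
  rw [Real.norm_eq_abs, Real.norm_eq_abs]
  refine pow_le_pow_left₀ (abs_nonneg _) ?_ 2
  simp only [PiLp.sub_apply, latticeVec_apply]
  by_cases h : k i = 0
  · simp [h]
  · have h1 : (1 : ℝ) ≤ |(k i : ℝ)| := one_le_abs_intCast h
    have h2 := abs_sub_abs_le_abs_sub (k i : ℝ) (z i)
    rw [abs_sub_comm] at h2
    linarith [hz i]

theorem half_le_norm_sub_latticeVec {z : EuclideanSpace ℝ (Fin n)} (hz : ∀ i, |z i| ≤ 1 / 2)
    {k : Fin n → ℤ} (hk : k ≠ 0) : 1 / 2 ≤ ‖z - latticeVec k‖ := by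
  obtain ⟨i, hi⟩ := Function.ne_iff.1 hk
  refine le_trans ?_ (abs_apply_le_norm _ i)
  have h1 : (1 : ℝ) ≤ |(k i : ℝ)| := one_le_abs_intCast hi
  have h2 := abs_sub_abs_le_abs_sub (k i : ℝ) (z i)
  rw [abs_sub_comm] at h2
  simp only [PiLp.sub_apply, latticeVec_apply]
  linarith [hz i]

theorem norm_le_of_abs_apply_le {z : EuclideanSpace ℝ (Fin n)} (hz : ∀ i, |z i| ≤ 1 / 2) :
    ‖z‖ ≤ n := by
  rw [EuclideanSpace.norm_eq]
  refine Real.sqrt_le_iff.2 ⟨by positivity, ?_⟩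
  calc ∑ i, ‖z i‖ ^ 2 ≤ ∑ _i : Fin n, (1 : ℝ) := by
        refine Finset.sum_le_sum fun i _ => ?_
        rw [Real.norm_eq_abs]
        nlinarith [hz i, abs_nonneg (z i)]
    _ = n := by simp
    _ ≤ (n : ℝ) ^ 2 := by exact_mod_cast Nat.le_self_pow two_ne_zero n

/-- Minimality of ‖c‖ is tested against the translates by ±e_i, using ‖c + m e_i‖² - ‖c‖² = 2 m c_i
+ m². -/
theorem IsRepresentativeBall.abs_apply_le {f : UnitAddTorus (Fin n) → 𝕜}
    {c : EuclideanSpace ℝ (Fin n)} {r : ℝ} (h : IsRepresentativeBall f c r) (i : Fin n) :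
    |c i| ≤ 1 / 2 := by
  have key : ∀ m : ℤ, 0 ≤ 2 * (m : ℝ) * c i + (m : ℝ) ^ 2 := by
    intro m
    have h1 := h.norm_le (Pi.single i m)
    have h2 : latticeVec (Pi.single i m) = EuclideanSpace.single i (m : ℝ) := by
      ext j
      by_cases hj : j = i
      · subst hj; simp
      · simp [hj]
    rw [h2] at h1
    have h3 := norm_add_sq_real c (EuclideanSpace.single i (m : ℝ))
    have h4 : ‖c‖ ^ 2 ≤ ‖c + EuclideanSpace.single i (m : ℝ)‖ ^ 2 := by gcongr
    rw [EuclideanSpace.inner_single_right, PiLp.norm_single] at h3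
    simp at h3
    linarith
  have h1 := key 1
  have h2 := key (-1)
  push_cast at h1 h2
  rw [abs_le]
  constructor <;> linarith

/-! ### Lattice sums of decaying kernels -/

theorem lintegral_comp_inv_smul {g : EuclideanSpace ℝ (Fin n) → ℝ≥0∞} (hg : Measurable g)
    {ζ : ℝ} (hζ : 0 < ζ) : ∫⁻ y, g (ζ⁻¹ • y) = ENNReal.ofReal (ζ ^ n) * ∫⁻ y, g y := by
  have h := Measure.map_addHaar_smul (volume : Measure (EuclideanSpace ℝ (Fin n)))
    (inv_ne_zero hζ.ne')
  rw [finrank_euclideanSpace_fin, inv_pow, inv_inv, abs_of_pos (by positivity)] at h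
  rw [← lintegral_map hg (measurable_const_smul _), h, lintegral_smul_measure, smul_eq_mul]

theorem lintegral_inv_pow_one_add_norm_lt_top :
    ∫⁻ y : EuclideanSpace ℝ (Fin n), ENNReal.ofReal (((1 + ‖y‖) ^ (n + 1))⁻¹) < ∞ := by
  have h := finite_integral_one_add_norm (μ := (volume : Measure (EuclideanSpace ℝ (Fin n))))
    (r := (n + 1 : ℕ)) (by simp)
  refine lt_of_eq_of_lt (lintegral_congr fun y => ?_) h
  rw [Real.rpow_neg (by positivity), Real.rpow_natCast]

/-- The kernel `ζ⁻ᵐ (1 + ‖z‖ / ζ)⁻ᵐ⁻¹`, which dominates the derivatives of order `m - n` of the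
`ζ`-dilates of a Schwartz function. -/
def decay (m : ℕ) (ζ : ℝ) (z : EuclideanSpace ℝ (Fin n)) : ℝ :=
  (ζ ^ m)⁻¹ * ((1 + ‖z‖ / ζ) ^ (m + 1))⁻¹

theorem decay_nonneg (m : ℕ) {ζ : ℝ} (hζ : 0 < ζ) (z : EuclideanSpace ℝ (Fin n)) :
    0 ≤ decay m ζ z := by
  unfold decay; positivity

theorem lintegral_decay {ζ : ℝ} (hζ : 0 < ζ) :
    ∫⁻ y : EuclideanSpace ℝ (Fin n), ENNReal.ofReal (decay n ζ y) =
      ∫⁻ y : EuclideanSpace ℝ (Fin n), ENNReal.ofReal (((1 + ‖y‖) ^ (n + 1))⁻¹) := by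
  have h := lintegral_comp_inv_smul (n := n)
    (g := fun y => ENNReal.ofReal (((1 + ‖y‖) ^ (n + 1))⁻¹)) (by fun_prop) hζ
  have h2 : ∀ y : EuclideanSpace ℝ (Fin n), ENNReal.ofReal (decay n ζ y) =
      ENNReal.ofReal ((ζ ^ n)⁻¹) * ENNReal.ofReal (((1 + ‖ζ⁻¹ • y‖) ^ (n + 1))⁻¹) := fun y => by
    rw [← ENNReal.ofReal_mul (by positivity), decay, norm_smul, Real.norm_of_nonneg (by positivity),
      div_eq_inv_mul]
  simp_rw [h2]
  rw [lintegral_const_mul _ (by fun_prop), h, ← mul_assoc, ← ENNReal.ofReal_mul (by positivity),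
    inv_mul_cancel₀ (by positivity), ENNReal.ofReal_one, one_mul]

theorem decay_le_of_norm_le (m : ℕ) {ζ a : ℝ} (hζ : 0 < ζ)
    {z w : EuclideanSpace ℝ (Fin n)} (h : 1 + ‖w‖ / ζ ≤ a * (1 + ‖z‖ / ζ)) :
    decay m ζ z ≤ a ^ (m + 1) * decay m ζ w := by
  have h1 : (1 + ‖w‖ / ζ) ^ (m + 1) ≤ a ^ (m + 1) * (1 + ‖z‖ / ζ) ^ (m + 1) := by
    rw [← mul_pow]; gcongr
  have h2 : ((1 + ‖z‖ / ζ) ^ (m + 1))⁻¹ ≤ a ^ (m + 1) * ((1 + ‖w‖ / ζ) ^ (m + 1))⁻¹ := by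
    rw [← div_eq_mul_inv, le_div_iff₀ (by positivity), inv_mul_le_iff₀ (by positivity)]
    linarith
  calc decay m ζ z ≤ (ζ ^ m)⁻¹ * (a ^ (m + 1) * ((1 + ‖w‖ / ζ) ^ (m + 1))⁻¹) := by
        unfold decay; gcongr
    _ = _ := by unfold decay; ring

/-- Riemann sums of `(1 + ‖y‖)⁻ⁿ⁻¹` with mesh at most one are bounded. -/
theorem exists_tsum_decay_le (n : ℕ) : ∃ C : ℝ≥0, ∀ ζ : ℝ, 1 ≤ ζ →
    ∀ z : EuclideanSpace ℝ (Fin n),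
      ∑' k : Fin n → ℤ, ENNReal.ofReal (decay n ζ (z - latticeVec k)) ≤ C := by
  set v := volume (Metric.closedBall (0 : EuclideanSpace ℝ (Fin n)) (1 / 3)) with hv
  set I := ∫⁻ y : EuclideanSpace ℝ (Fin n), ENNReal.ofReal (((1 + ‖y‖) ^ (n + 1))⁻¹) with hI
  have hv0 : v ≠ 0 := (Metric.measure_closedBall_pos _ _ (by norm_num)).ne'
  have hvt : v ≠ ∞ := measure_closedBall_lt_top.ne
  have hIt : I ≠ ∞ := lintegral_inv_pow_one_add_norm_lt_top.ne
  have hCt : (2 ^ (n + 1) * I) / v ≠ ∞ :=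
    ENNReal.div_ne_top (ENNReal.mul_ne_top (by finiteness) hIt) hv0
  refine ⟨((2 ^ (n + 1) * I) / v).toNNReal, fun ζ hζ z => ?_⟩
  have hζ0 : 0 < ζ := by linarith
  rw [ENNReal.coe_toNNReal hCt, ENNReal.le_div_iff_mul_le (Or.inl hv0) (Or.inl hvt),
    ← ENNReal.tsum_mul_right]
  -- Moving the argument by at most 1/3 ≤ ζ changes 1 + ‖·‖/ζ by a factor of at most 2, so each term
  -- is controlled by an integral over a ball around its lattice point. Radius 1/3 < 1/2 keeps these
  -- balls disjoint.
  have hterm : ∀ k : Fin n → ℤ, ENNReal.ofReal (decay n ζ (z - latticeVec k)) * v ≤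
      2 ^ (n + 1) * ∫⁻ u in Metric.closedBall (0 + latticeVec k) (1 / 3),
        ENNReal.ofReal (decay n ζ (z - u)) := by
    intro k
    have hvk : v = volume (Metric.closedBall (0 + latticeVec k) (1 / 3)) := by
      rw [hv, Measure.addHaar_closedBall_center, ← Measure.addHaar_closedBall_center _ (0 + _)]
    rw [hvk, ← setLIntegral_const, ← lintegral_const_mul' _ _ (by finiteness)]
    refine setLIntegral_mono' measurableSet_closedBall fun u hu => ?_
    have h2 : (2 : ℝ≥0∞) ^ (n + 1) = ENNReal.ofReal (2 ^ (n + 1)) := by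
      rw [ENNReal.ofReal_pow (by norm_num)]; simp
    rw [h2, ← ENNReal.ofReal_mul (by positivity)]
    refine ENNReal.ofReal_le_ofReal (decay_le_of_norm_le n hζ0 ?_)
    rw [Metric.mem_closedBall, zero_add, dist_eq_norm, norm_sub_rev] at hu
    have h3 : ‖z - u‖ ≤ ‖z - latticeVec k‖ + 1 := by
      have := norm_add_le (z - latticeVec k) (latticeVec k - u)
      rw [sub_add_sub_cancel] at this
      linarith
    have h4 : ‖z - u‖ / ζ ≤ ‖z - latticeVec k‖ / ζ + 1 := by
      rw [div_le_iff₀ hζ0, add_mul, div_mul_cancel₀ _ hζ0.ne']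
      linarith
    have h5 : 0 ≤ ‖z - latticeVec k‖ / ζ := by positivity
    linarith
  calc _ ≤ ∑' k : Fin n → ℤ, 2 ^ (n + 1) * ∫⁻ u in Metric.closedBall (0 + latticeVec k) (1 / 3),
        ENNReal.ofReal (decay n ζ (z - u)) := ENNReal.tsum_le_tsum hterm
    _ = 2 ^ (n + 1) * ∫⁻ u in ⋃ k : Fin n → ℤ, Metric.closedBall (0 + latticeVec k) (1 / 3),
        ENNReal.ofReal (decay n ζ (z - u)) := by
      rw [ENNReal.tsum_mul_left, lintegral_iUnion (fun _ => measurableSet_closedBall)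
        (pairwise_disjoint_closedBall_latticeVec 0 (by norm_num))]
    _ ≤ 2 ^ (n + 1) * ∫⁻ u, ENNReal.ofReal (decay n ζ (z - u)) := by
      gcongr; exact Measure.restrict_le_self
    _ = 2 ^ (n + 1) * I := by
      rw [lintegral_sub_left_eq_self (fun u => ENNReal.ofReal (decay n ζ u)) z, lintegral_decay hζ0]

theorem decay_le_inv_norm_pow (m : ℕ) {ζ : ℝ} (hζ : 0 < ζ) {z : EuclideanSpace ℝ (Fin n)}
    (hz : z ≠ 0) : decay m ζ z ≤ (‖z‖ ^ m)⁻¹ := by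
  have hz' : 0 < ‖z‖ := norm_pos_iff.2 hz
  unfold decay
  rw [← mul_inv]
  refine inv_anti₀ (by positivity) ?_
  calc ‖z‖ ^ m ≤ (ζ * (1 + ‖z‖ / ζ)) ^ m := by
        gcongr
        rw [mul_add, mul_div_cancel₀ _ hζ.ne']; linarith
    _ = ζ ^ m * (1 + ‖z‖ / ζ) ^ m := mul_pow _ _ _
    _ ≤ ζ ^ m * (1 + ‖z‖ / ζ) ^ (m + 1) := by
        gcongr
        · have : 0 ≤ ‖z‖ / ζ := by positivity
          linarith
        · omega

theorem decay_le_of_one_le {m : ℕ} (hm : n ≤ m) {ζ : ℝ} (hζ : 1 ≤ ζ)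
    (z : EuclideanSpace ℝ (Fin n)) : decay m ζ z ≤ decay n ζ z := by
  have : 0 ≤ ‖z‖ / ζ := by positivity
  unfold decay
  gcongr
  all_goals linarith

/-- For ζ ≤ 1 the surplus power in `decay` leaves ‖z‖^(-(m+1)) uniformly in ζ, which is still
summable over the lattice; the 3 comes from 1 + t ≤ 3t for t ≥ 1/2. -/
theorem decay_le_of_half_le_norm {m : ℕ} (hm : n ≤ m) {ζ : ℝ} (hζ : 0 < ζ) (hζ1 : ζ ≤ 1)
    {z : EuclideanSpace ℝ (Fin n)} (hz : 1 / 2 ≤ ‖z‖) :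
    decay m ζ z ≤ 3 ^ (m + 1) * decay n 1 z := by
  have hz' : 0 < ‖z‖ := by linarith
  have h1 : decay m ζ z ≤ (‖z‖ ^ (m + 1))⁻¹ := by
    unfold decay
    rw [← mul_inv]
    refine inv_anti₀ (by positivity) ?_
    calc ‖z‖ ^ (m + 1) ≤ (ζ * (1 + ‖z‖ / ζ)) ^ (m + 1) := by
          gcongr
          rw [mul_add, mul_div_cancel₀ _ hζ.ne']; linarith
      _ = ζ ^ (m + 1) * (1 + ‖z‖ / ζ) ^ (m + 1) := mul_pow _ _ _
      _ ≤ ζ ^ m * (1 + ‖z‖ / ζ) ^ (m + 1) := by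
          gcongr ?_ * _
          exact pow_le_pow_of_le_one hζ.le hζ1 (by omega)
  refine h1.trans ?_
  have h2 : (1 + ‖z‖) ^ (n + 1) ≤ 3 ^ (m + 1) * ‖z‖ ^ (m + 1) := by
    calc (1 + ‖z‖) ^ (n + 1) ≤ (1 + ‖z‖) ^ (m + 1) :=
          pow_le_pow_right₀ (by linarith) (by omega)
      _ ≤ (3 * ‖z‖) ^ (m + 1) := by gcongr; linarith
      _ = _ := mul_pow _ _ _
  unfold decay
  rw [one_pow, inv_one, one_mul, div_one, ← div_eq_mul_inv, le_div_iff₀ (by positivity),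
    inv_mul_le_iff₀ (by positivity)]
  linarith

/-- The periodization of `decay m ζ` is dominated near the origin by `‖z‖⁻ᵐ`, uniformly in `ζ`. -/
theorem exists_tsum_decay_le_inv_norm_pow {m : ℕ} (hm : n ≤ m) : ∃ C : ℝ≥0, ∀ ζ : ℝ, 0 < ζ →
    ∀ z : EuclideanSpace ℝ (Fin n), z ≠ 0 → (∀ i, |z i| ≤ 1 / 2) →
      ∑' k : Fin n → ℤ, ENNReal.ofReal (decay m ζ (z - latticeVec k)) ≤
        C * ENNReal.ofReal ((‖z‖ ^ m)⁻¹) := by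
  classical
  obtain ⟨C, hC⟩ := exists_tsum_decay_le n
  refine ⟨1 + 3 ^ (m + 1) * C * n ^ m, fun ζ hζ z hz0 hz => ?_⟩
  have hz' : 0 < ‖z‖ := norm_pos_iff.2 hz0
  -- Only k = 0 is singular. The other lattice points are at distance at least 1/2 from z, so scales
  -- below 1 may be replaced by scale 1, where the Riemann sum bound applies.
  have hterm : ∀ k : Fin n → ℤ, ENNReal.ofReal (decay m ζ (z - latticeVec k)) ≤
      (if k = 0 then ENNReal.ofReal ((‖z‖ ^ m)⁻¹) else 0) +
        3 ^ (m + 1) * ENNReal.ofReal (decay n (max ζ 1) (z - latticeVec k)) := by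
    intro k
    by_cases hk : k = 0
    · subst hk
      have h0 : latticeVec (0 : Fin n → ℤ) = 0 := by ext i; simp
      rw [if_pos rfl, h0, sub_zero]
      exact le_add_right (ENNReal.ofReal_le_ofReal (decay_le_inv_norm_pow m hζ hz0))
    · rw [if_neg hk, zero_add]
      have h3 : (3 : ℝ≥0∞) ^ (m + 1) = ENNReal.ofReal (3 ^ (m + 1)) := by
        rw [ENNReal.ofReal_pow (by norm_num)]; simp
      rw [h3, ← ENNReal.ofReal_mul (by positivity)]
      refine ENNReal.ofReal_le_ofReal ?_
      rcases le_total 1 ζ with h1 | h1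
      · rw [max_eq_left h1]
        refine (decay_le_of_one_le hm h1 _).trans ?_
        exact le_mul_of_one_le_left (decay_nonneg n hζ _) (one_le_pow₀ (by norm_num))
      · rw [max_eq_right h1]
        exact decay_le_of_half_le_norm hm hζ h1 (half_le_norm_sub_latticeVec hz hk)
  -- Since ‖z‖ ≤ n, the constant bounding the nonzero lattice points is absorbed into ‖z‖⁻ᵐ.
  have hone : (1 : ℝ≥0∞) ≤ n ^ m * ENNReal.ofReal ((‖z‖ ^ m)⁻¹) := by
    rw [← ENNReal.ofReal_natCast, ← ENNReal.ofReal_pow (by positivity),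
      ← ENNReal.ofReal_mul (by positivity), ENNReal.one_le_ofReal, ← div_eq_mul_inv,
      one_le_div (by positivity)]
    have := norm_le_of_abs_apply_le hz
    gcongr
  calc _ ≤ ∑' k : Fin n → ℤ, ((if k = 0 then ENNReal.ofReal ((‖z‖ ^ m)⁻¹) else 0) +
        3 ^ (m + 1) * ENNReal.ofReal (decay n (max ζ 1) (z - latticeVec k))) :=
        ENNReal.tsum_le_tsum hterm
    _ = ENNReal.ofReal ((‖z‖ ^ m)⁻¹) +
        3 ^ (m + 1) * ∑' k : Fin n → ℤ,
          ENNReal.ofReal (decay n (max ζ 1) (z - latticeVec k)) := by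
      rw [ENNReal.tsum_add, ENNReal.tsum_mul_left, tsum_ite_eq]
    _ ≤ ENNReal.ofReal ((‖z‖ ^ m)⁻¹) + 3 ^ (m + 1) * C *
          (n ^ m * ENNReal.ofReal ((‖z‖ ^ m)⁻¹)) := by
      rw [mul_assoc]
      gcongr _ + _ * ?_
      exact (hC _ (le_max_right _ _) z).trans (le_mul_of_one_le_right zero_le hone)
    _ = _ := by push_cast; ring

/-! ### Taylor expansion of Schwartz functions -/

theorem iteratedDeriv_comp_line {E F : Type*} [NormedAddCommGroup E] [NormedSpace ℝ E]
    [NormedAddCommGroup F] [NormedSpace ℝ F] {G : E → F} {m : ℕ} (hG : ContDiff ℝ m G)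
    (a v : E) (t : ℝ) :
    iteratedDeriv m (fun t : ℝ => G (a + t • v)) t = iteratedFDeriv ℝ m G (a + t • v) fun _ => v := by
  have h := (ContinuousLinearMap.toSpanSingleton ℝ v).iteratedFDeriv_comp_right
    (f := fun z => G (a + z)) (n := m) (by fun_prop) t (i := m) le_rfl
  rw [iteratedFDeriv_comp_add_left] at h
  rw [iteratedDeriv_eq_iteratedFDeriv]
  have h2 : (fun t : ℝ => G (a + t • v)) =
      (fun z => G (a + z)) ∘ ⇑(ContinuousLinearMap.toSpanSingleton ℝ v) := by
    ext t; simp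
  rw [h2, h]
  simp

/-- Taylor's formula along a segment in a normed space. -/
theorem norm_sub_sum_iteratedFDeriv_le {E F : Type*} [NormedAddCommGroup E] [NormedSpace ℝ E]
    [NormedAddCommGroup F] [NormedSpace ℝ F] {G : E → F} {N : ℕ} (hG : ContDiff ℝ (N + 1 : ℕ) G)
    (a v : E) {C : ℝ}
    (hC : ∀ t ∈ Set.Icc (0 : ℝ) 1, ‖iteratedFDeriv ℝ (N + 1) G (a + t • v)‖ ≤ C) :
    ‖G (a + v) - ∑ j ∈ Finset.range (N + 1),
      ((j.factorial : ℝ)⁻¹ • iteratedFDeriv ℝ j G a fun _ => v)‖ ≤ C * ‖v‖ ^ (N + 1) := by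
  have hu : UniqueDiffOn ℝ (Set.Icc (0 : ℝ) 1) := uniqueDiffOn_Icc zero_lt_one
  have hline : ContDiff ℝ (N + 1 : ℕ) fun t : ℝ => G (a + t • v) :=
    hG.comp (contDiff_const.add (contDiff_id.smul contDiff_const))
  have hd : ∀ j ≤ N + 1, ∀ t ∈ Set.Icc (0 : ℝ) 1,
      iteratedDerivWithin j (fun t : ℝ => G (a + t • v)) (Set.Icc 0 1) t =
        iteratedFDeriv ℝ j G (a + t • v) fun _ => v := by
    intro j hj t ht
    have hj' : (j : WithTop ℕ∞) ≤ (N + 1 : ℕ) := by exact_mod_cast hj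
    rw [iteratedDerivWithin_eq_iteratedDeriv hu (hline.of_le hj').contDiffAt ht,
      iteratedDeriv_comp_line (hG.of_le hj')]
  have h := taylor_mean_remainder_bound (f := fun t : ℝ => G (a + t • v)) (a := 0) (b := 1)
    (x := 1) (n := N) (C := C * ‖v‖ ^ (N + 1)) zero_le_one (by exact_mod_cast hline.contDiffOn)
    (by simp) (fun t ht => by
      rw [hd _ le_rfl t ht]
      refine (ContinuousMultilinearMap.le_opNorm _ _).trans ?_
      rw [Finset.prod_const, Finset.card_univ, Fintype.card_fin]
      gcongr
      exact hC t ht)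
  rw [taylor_within_apply] at h
  have hsum : ∑ j ∈ Finset.range (N + 1), (((j.factorial : ℝ)⁻¹ * (1 - 0) ^ j) •
      iteratedDerivWithin j (fun t : ℝ => G (a + t • v)) (Set.Icc 0 1) 0) =
      ∑ j ∈ Finset.range (N + 1), ((j.factorial : ℝ)⁻¹ • iteratedFDeriv ℝ j G a fun _ => v) := by
    refine Finset.sum_congr rfl fun j hj => ?_
    rw [hd j (by simp at hj; omega) 0 (by simp)]
    simp
  rw [hsum, one_smul] at h
  refine h.trans ?_
  have h0 : 0 ≤ C := (norm_nonneg _).trans (hC 0 (by simp))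
  rw [sub_zero, one_pow, mul_one]
  exact div_le_self (by positivity) (by exact_mod_cast Nat.one_le_iff_ne_zero.2 N.factorial_ne_zero)

theorem exists_norm_iteratedFDeriv_le (Ψ : SchwartzMap (EuclideanSpace ℝ (Fin n)) 𝕜) (j m : ℕ) :
    ∃ K : ℝ≥0, ∀ w, ‖iteratedFDeriv ℝ j Ψ w‖ ≤ K * ((1 + ‖w‖) ^ m)⁻¹ := by
  set K := 2 ^ m * ((Finset.Iic (m, j)).sup fun q => SchwartzMap.seminorm ℝ q.1 q.2) Ψ
  have hK : 0 ≤ K := by positivity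
  refine ⟨K.toNNReal, fun w => ?_⟩
  have h := SchwartzMap.one_add_le_sup_seminorm_apply (𝕜 := ℝ) (m := (m, j)) (k := m) (n := j)
    le_rfl le_rfl Ψ w
  rw [Real.coe_toNNReal K hK, ← div_eq_mul_inv, le_div_iff₀ (by positivity)]
  linarith

/-! ### Moments indexed by words -/

/-- Summing over words in the coordinates rather than multiindices avoids multinomial coefficients
and any appeal to symmetry. -/
theorem multilinear_apply_eq_sum {j : ℕ}
    (T : ContinuousMultilinearMap ℝ (fun _ : Fin j => EuclideanSpace ℝ (Fin n)) 𝕜)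
    (v : EuclideanSpace ℝ (Fin n)) :
    (T fun _ => v) = ∑ s : Fin j → Fin n,
      ((∏ l, v (s l) : ℝ) : 𝕜) * T fun l => EuclideanSpace.single (s l) 1 := by
  have hv : v = ∑ i, v i • EuclideanSpace.single i (1 : ℝ) := by
    have := (EuclideanSpace.basisFun (Fin n) ℝ).sum_repr v
    simpa using this.symm
  conv_lhs => rw [hv]
  rw [T.map_sum (fun _ i => v i • EuclideanSpace.single i (1 : ℝ))]
  refine Finset.sum_congr rfl fun s _ => ?_
  rw [T.map_smul_univ, RCLike.real_smul_eq_coe_mul]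

theorem enorm_multilinear_single_le {j : ℕ}
    (T : ContinuousMultilinearMap ℝ (fun _ : Fin j => EuclideanSpace ℝ (Fin n)) 𝕜)
    (s : Fin j → Fin n) : ‖T fun l => EuclideanSpace.single (s l) 1‖ₑ ≤ ENNReal.ofReal ‖T‖ := by
  rw [← ofReal_norm]
  refine ENNReal.ofReal_le_ofReal ((T.le_opNorm _).trans ?_)
  simp

theorem integrableOn_mul_periodicExt {f : UnitAddTorus (Fin n) → 𝕜} (hf : MemLp f ∞ volume)
    {g : EuclideanSpace ℝ (Fin n) → 𝕜} (hg : Continuous g) (c : EuclideanSpace ℝ (Fin n)) (r : ℝ) :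
    IntegrableOn (fun y => g y * periodicExt f y) (Metric.closedBall c r) := by
  refine Integrable.mul_bdd (c := (eLpNorm f ∞ volume).toReal)
    (hg.continuousOn.integrableOn_compact (isCompact_closedBall c r))
    (aestronglyMeasurable_periodicExt hf.1).restrict ?_
  refine ae_restrict_of_ae ((ae_enorm_periodicExt_le f).mono fun x hx => ?_)
  rw [← toReal_enorm]
  exact ENNReal.toReal_mono hf.2.ne hx

/-- Moments with respect to products of coordinates centered at `c` are controlled by the moments
of at most the same order. -/
theorem enorm_integral_prod_sub_mul_le {f : UnitAddTorus (Fin n) → 𝕜} (hf : MemLp f ∞ volume)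
    {c : EuclideanSpace ℝ (Fin n)} (hc : ∀ i, |c i| ≤ 1) (r : ℝ) {N j : ℕ} (hj : j ≤ N)
    {M : ℝ≥0∞} (hM : ∀ α : Fin n → ℕ, ∑ i, α i ≤ N → ‖moment f c r α‖ₑ ≤ M)
    (s : Fin j → Fin n) :
    ‖∫ y in Metric.closedBall c r, ((∏ l, (c - y) (s l) : ℝ) : 𝕜) * periodicExt f y‖ₑ ≤
      2 ^ j * M := by
  classical
  -- The set `t` collects the letters where -y is chosen over c. Counting the letters of `t` equal
  -- to each i gives a multiindex of order `t.card ≤ j`. The coefficients are at most 1 because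
  -- |c_i| ≤ 1, and there are 2^j sets.
  have hexp : ∀ y : EuclideanSpace ℝ (Fin n),
      ((∏ l, (c - y) (s l) : ℝ) : 𝕜) * periodicExt f y =
        ∑ t ∈ (Finset.univ : Finset (Fin j)).powerset,
          (((-1) ^ t.card * ∏ l ∈ Finset.univ \ t, c (s l) : ℝ) : 𝕜) *
          (((∏ i, y i ^ (t.filter fun l => s l = i).card : ℝ) : 𝕜) * periodicExt f y) := by
    intro y
    have h1 : ∏ l, (c - y) (s l) = ∑ t ∈ (Finset.univ : Finset (Fin j)).powerset,
        ((-1) ^ t.card * ∏ l ∈ Finset.univ \ t, c (s l)) *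
          ∏ i, y i ^ (t.filter fun l => s l = i).card := by
      have : ∀ l, (c - y) (s l) = -y (s l) + c (s l) := fun l => by
        rw [PiLp.sub_apply]; ring
      simp_rw [this]
      rw [Finset.prod_add]
      refine Finset.sum_congr rfl fun t _ => ?_
      have h2 : ∏ l ∈ t, y (s l) = ∏ i, y i ^ (t.filter fun l => s l = i).card := by
        rw [← Finset.prod_fiberwise t s]
        refine Finset.prod_congr rfl fun i _ => ?_
        refine (Finset.prod_congr rfl fun l hl => ?_).trans (Finset.prod_const _)
        rw [(Finset.mem_filter.1 hl).2]
      rw [Finset.prod_neg, h2]; ring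
    rw [h1]
    push_cast
    rw [Finset.sum_mul]
    exact Finset.sum_congr rfl fun t _ => by ring
  simp_rw [hexp]
  rw [integral_finsetSum]
  swap
  · intro t _
    refine Integrable.const_mul (integrableOn_mul_periodicExt hf ?_ c r) _
    exact RCLike.continuous_ofReal.comp (by fun_prop)
  refine (enorm_sum_le _ _).trans ?_
  have hterm : ∀ t ∈ (Finset.univ : Finset (Fin j)).powerset,
      ‖∫ y in Metric.closedBall c r, (((-1) ^ t.card * ∏ l ∈ Finset.univ \ t, c (s l) : ℝ) : 𝕜) *
          (((∏ i, y i ^ (t.filter fun l => s l = i).card : ℝ) : 𝕜) * periodicExt f y)‖ₑ ≤ M := by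
    intro t _
    rw [integral_const_mul, enorm_mul]
    have h1 : ‖(((-1) ^ t.card * ∏ l ∈ Finset.univ \ t, c (s l) : ℝ) : 𝕜)‖ₑ ≤ 1 := by
      rw [← ofReal_norm, ENNReal.ofReal_le_one, RCLike.norm_ofReal, abs_mul, abs_pow,
        abs_neg, abs_one, one_pow, one_mul, Finset.abs_prod]
      exact Finset.prod_le_one (fun _ _ => abs_nonneg _) fun l _ => hc _
    have h2 := hM (fun i => (t.filter fun l => s l = i).card) (by
      rw [← Finset.card_eq_sum_card_fiberwise (f := s) (s := t) (t := Finset.univ) (by simp)]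
      exact (Finset.card_le_univ t).trans (by simpa using hj))
    calc _ ≤ 1 * M := by gcongr; exact h2
      _ = M := one_mul M
  refine (Finset.sum_le_sum hterm).trans ?_
  simp

theorem enorm_integral_multilinear_mul_le {f : UnitAddTorus (Fin n) → 𝕜} (hf : MemLp f ∞ volume)
    {c : EuclideanSpace ℝ (Fin n)} (hc : ∀ i, |c i| ≤ 1) (r : ℝ) {N j : ℕ} (hj : j ≤ N)
    {M : ℝ≥0∞} (hM : ∀ α : Fin n → ℕ, ∑ i, α i ≤ N → ‖moment f c r α‖ₑ ≤ M)
    (T : ContinuousMultilinearMap ℝ (fun _ : Fin j => EuclideanSpace ℝ (Fin n)) 𝕜) :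
    ‖∫ y in Metric.closedBall c r, (T fun _ => c - y) * periodicExt f y‖ₑ ≤
      ENNReal.ofReal ‖T‖ * ((2 * n) ^ j * M) := by
  have hexp : ∀ y : EuclideanSpace ℝ (Fin n), (T fun _ => c - y) * periodicExt f y =
      ∑ s : Fin j → Fin n, (T fun l => EuclideanSpace.single (s l) 1) *
        (((∏ l, (c - y) (s l) : ℝ) : 𝕜) * periodicExt f y) := fun y => by
    rw [multilinear_apply_eq_sum, Finset.sum_mul]
    exact Finset.sum_congr rfl fun s _ => by ring
  simp_rw [hexp]
  rw [integral_finsetSum]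
  swap
  · intro s _
    refine Integrable.const_mul (integrableOn_mul_periodicExt hf ?_ c r) _
    exact RCLike.continuous_ofReal.comp (by fun_prop)
  refine (enorm_sum_le _ _).trans ?_
  calc _ ≤ ∑ _s : Fin j → Fin n, ENNReal.ofReal ‖T‖ * (2 ^ j * M) := by
        refine Finset.sum_le_sum fun s _ => ?_
        rw [integral_const_mul, enorm_mul]
        gcongr
        · exact enorm_multilinear_single_le T s
        · exact enorm_integral_prod_sub_mul_le hf hc r hj hM s
    _ = _ := by
        simp only [Finset.sum_const, Finset.card_univ, Fintype.card_pi, Fintype.card_fin,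
          Finset.prod_const, nsmul_eq_mul, mul_pow]
        push_cast
        ring

theorem inv_pow_mul_inv_pow_mul_eq_decay {ζ : ℝ} (hζ : 0 < ζ) (j : ℕ)
    (w : EuclideanSpace ℝ (Fin n)) :
    (ζ ^ n)⁻¹ * ζ⁻¹ ^ j * ((1 + ‖ζ⁻¹ • w‖) ^ (n + j + 1))⁻¹ = decay (n + j) ζ w := by
  rw [decay, norm_smul, Real.norm_of_nonneg (by positivity), div_eq_inv_mul, pow_add ζ, mul_inv,
    inv_pow]

/-- Taylor's formula for Ψ at w/ζ with increment h/ζ. As ‖h‖ ≤ ε ≤ ‖w‖/2, the whole segment keeps at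
least half of 1 + ‖w‖/ζ, which costs only the power of 2. -/
theorem norm_dilate_sub_taylor_le (Ψ : SchwartzMap (EuclideanSpace ℝ (Fin n)) 𝕜) {N : ℕ} {K : ℝ≥0}
    (hK : ∀ w, ‖iteratedFDeriv ℝ (N + 1) Ψ w‖ ≤ K * ((1 + ‖w‖) ^ (n + (N + 1) + 1))⁻¹)
    {ζ ε : ℝ} (hζ : 0 < ζ) {w h : EuclideanSpace ℝ (Fin n)} (hw : 2 * ε ≤ ‖w‖) (hh : ‖h‖ ≤ ε) :
    ‖dilate Ψ ζ (w + h) - ∑ j ∈ Finset.range (N + 1),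
      ((ζ ^ n)⁻¹ * (j.factorial : ℝ)⁻¹ * ζ⁻¹ ^ j) •
        iteratedFDeriv ℝ j Ψ (ζ⁻¹ • w) (fun _ => h)‖ ≤
      K * 2 ^ (n + (N + 1) + 1) * decay (n + (N + 1)) ζ w * ε ^ (N + 1) := by
  have hε : 0 ≤ ε := (norm_nonneg h).trans hh
  have hT := norm_sub_sum_iteratedFDeriv_le (G := Ψ) (N := N) (Ψ.smooth _) (ζ⁻¹ • w) (ζ⁻¹ • h)
    (C := K * (2 ^ (n + (N + 1) + 1) * ((1 + ‖ζ⁻¹ • w‖) ^ (n + (N + 1) + 1))⁻¹)) (fun t ht => by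
      refine (hK _).trans ?_
      gcongr
      rw [← div_eq_mul_inv, le_div_iff₀ (by positivity), inv_mul_le_iff₀ (by positivity),
        mul_comm, ← mul_pow]
      gcongr
      have h1 : ‖t • ζ⁻¹ • h‖ ≤ ζ⁻¹ * ε := by
        rw [norm_smul, norm_smul, Real.norm_of_nonneg ht.1, Real.norm_of_nonneg (by positivity)]
        exact (mul_le_of_le_one_left (by positivity) ht.2).trans (by gcongr)
      have h2 : ζ⁻¹ * (2 * ε) ≤ ‖ζ⁻¹ • w‖ := by
        rw [norm_smul, Real.norm_of_nonneg (by positivity)]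
        gcongr
      have h3 := norm_sub_le (ζ⁻¹ • w + t • ζ⁻¹ • h) (t • ζ⁻¹ • h)
      rw [add_sub_cancel_right] at h3
      linarith)
  have hE : dilate Ψ ζ (w + h) - ∑ j ∈ Finset.range (N + 1),
      ((ζ ^ n)⁻¹ * (j.factorial : ℝ)⁻¹ * ζ⁻¹ ^ j) •
        iteratedFDeriv ℝ j Ψ (ζ⁻¹ • w) (fun _ => h) =
      (ζ ^ n)⁻¹ • (Ψ (ζ⁻¹ • w + ζ⁻¹ • h) - ∑ j ∈ Finset.range (N + 1),
        ((j.factorial : ℝ)⁻¹ • iteratedFDeriv ℝ j Ψ (ζ⁻¹ • w) fun _ => ζ⁻¹ • h)) := by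
    rw [smul_sub, dilate, smul_add, Finset.smul_sum]
    congr 1
    refine Finset.sum_congr rfl fun j _ => ?_
    rw [ContinuousMultilinearMap.map_smul_univ (iteratedFDeriv ℝ j Ψ (ζ⁻¹ • w)) (fun _ => ζ⁻¹)
      (fun _ => h), Finset.prod_const, Finset.card_univ, Fintype.card_fin, smul_smul, smul_smul,
      mul_assoc]
  rw [hE, norm_smul, Real.norm_of_nonneg (by positivity), ← inv_pow_mul_inv_pow_mul_eq_decay hζ]
  have hn : ‖ζ⁻¹ • h‖ ≤ ζ⁻¹ * ε := by
    rw [norm_smul, Real.norm_of_nonneg (by positivity)]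
    gcongr
  calc _ ≤ (ζ ^ n)⁻¹ * (K * (2 ^ (n + (N + 1) + 1) *
        ((1 + ‖ζ⁻¹ • w‖) ^ (n + (N + 1) + 1))⁻¹) * (ζ⁻¹ * ε) ^ (N + 1)) := by
        gcongr
        exact hT.trans (by gcongr)
    _ = _ := by rw [mul_pow]; ring

/-- The contribution of one copy of the supporting ball to a convolution with a dilate of a
Schwartz function. -/
theorem exists_enorm_integral_ball_le (Ψ : SchwartzMap (EuclideanSpace ℝ (Fin n)) 𝕜) (N : ℕ) :
    ∃ K : ℝ≥0, ∀ f : UnitAddTorus (Fin n) → 𝕜, MemLp f ∞ volume →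
      ∀ c : EuclideanSpace ℝ (Fin n), (∀ i, |c i| ≤ 1) → ∀ ε : ℝ, 0 < ε → ∀ M : ℝ≥0∞,
      (∀ α : Fin n → ℕ, ∑ i, α i ≤ N → ‖moment f c ε α‖ₑ ≤ M) →
      ∀ ζ : ℝ, 0 < ζ → ∀ w : EuclideanSpace ℝ (Fin n), 2 * ε ≤ ‖w‖ →
      ‖∫ y in Metric.closedBall c ε, dilate Ψ ζ (w + (c - y)) * periodicExt f y‖ₑ ≤
        K * ((∑ j ∈ Finset.range (N + 1), ENNReal.ofReal (decay (n + j) ζ w)) * M +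
          ENNReal.ofReal (decay (n + (N + 1)) ζ w) *
            (ENNReal.ofReal (ε ^ (n + (N + 1))) * eLpNorm f ∞ volume)) := by
  -- The exponent n + j + 1 is the one for which the rescaled j-th derivative is exactly bounded by
  -- `decay (n + j) ζ`.
  choose K hK using fun j => exists_norm_iteratedFDeriv_le Ψ j (n + j + 1)
  set V := volume (Metric.ball (0 : EuclideanSpace ℝ (Fin n)) 1) with hV
  have hVt : V ≠ ∞ := measure_ball_lt_top.ne
  set K₁ : ℝ≥0 := ∑ j ∈ Finset.range (N + 1), K j * (2 * n) ^ j with hK₁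
  set K₂ : ℝ≥0 := K (N + 1) * 2 ^ (n + (N + 1) + 1) * V.toNNReal with hK₂
  refine ⟨K₁ + K₂, fun f hf c hc ε hε M hM ζ hζ w hw => ?_⟩
  set T := fun j => iteratedFDeriv ℝ j Ψ (ζ⁻¹ • w) with hT
  set a : ℕ → ℝ := fun j => (ζ ^ n)⁻¹ * (j.factorial : ℝ)⁻¹ * ζ⁻¹ ^ j with ha
  set P : EuclideanSpace ℝ (Fin n) → 𝕜 :=
    fun y => ∑ j ∈ Finset.range (N + 1), a j • T j (fun _ => c - y) with hP
  have hTc : ∀ j, Continuous fun y => T j (fun _ => c - y) := fun j =>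
    (T j).cont.comp (by fun_prop)
  have hPc : Continuous P := continuous_finsetSum _ fun j _ => (hTc j).const_smul (a j)
  have hDc : Continuous fun y => dilate Ψ ζ (w + (c - y)) := by
    unfold dilate
    exact (Ψ.continuous.comp (by fun_prop)).const_smul _
  have hRc : Continuous fun y => dilate Ψ ζ (w + (c - y)) - P y := hDc.sub hPc
  have hsplit : ∀ y, dilate Ψ ζ (w + (c - y)) * periodicExt f y =
      P y * periodicExt f y + (dilate Ψ ζ (w + (c - y)) - P y) * periodicExt f y := fun y => by
    ring
  simp_rw [hsplit]
  rw [integral_add (integrableOn_mul_periodicExt hf hPc c ε)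
    (integrableOn_mul_periodicExt hf hRc c ε)]
  have hmain : ‖∫ y in Metric.closedBall c ε, P y * periodicExt f y‖ₑ ≤
      K₁ * ((∑ j ∈ Finset.range (N + 1), ENNReal.ofReal (decay (n + j) ζ w)) * M) := by
    have h1 : ∀ y, P y * periodicExt f y = ∑ j ∈ Finset.range (N + 1),
        a j • (T j (fun _ => c - y) * periodicExt f y) := fun y => by
      simp only [hP, Finset.sum_mul, smul_mul_assoc]
    simp_rw [h1]
    rw [integral_finsetSum]
    swap
    · exact fun j _ => (integrableOn_mul_periodicExt hf (hTc j) c ε).smul (a j)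
    refine (enorm_sum_le _ _).trans ?_
    rw [Finset.sum_mul, Finset.mul_sum]
    refine Finset.sum_le_sum fun j hj => ?_
    have hjN : j ≤ N := by simp at hj; omega
    rw [integral_smul, enorm_smul]
    have hreal : |a j| * ‖T j‖ ≤ K j * decay (n + j) ζ w := by
      rw [abs_of_nonneg (by positivity), ← inv_pow_mul_inv_pow_mul_eq_decay hζ]
      have hf1 : (j.factorial : ℝ)⁻¹ ≤ 1 :=
        inv_le_one_of_one_le₀ (by exact_mod_cast Nat.one_le_iff_ne_zero.2 j.factorial_ne_zero)
      calc a j * ‖T j‖ ≤ ((ζ ^ n)⁻¹ * 1 * ζ⁻¹ ^ j) *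
            (K j * ((1 + ‖ζ⁻¹ • w‖) ^ (n + j + 1))⁻¹) := by
            simp only [ha, hT]
            gcongr
            exact hK j _
        _ = _ := by ring
    have hKj : (K j : ℝ≥0∞) * (2 * n) ^ j ≤ K₁ := by
      have : K j * (2 * n) ^ j ≤ K₁ :=
        Finset.single_le_sum (f := fun j => K j * (2 * (n : ℝ≥0)) ^ j) (fun _ _ => by positivity) hj
      exact_mod_cast this
    calc _ ≤ ENNReal.ofReal |a j| * (ENNReal.ofReal ‖T j‖ * ((2 * n) ^ j * M)) := by
          rw [← Real.norm_eq_abs, ofReal_norm]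
          gcongr
          exact enorm_integral_multilinear_mul_le hf hc ε hjN hM (T j)
      _ = ENNReal.ofReal (|a j| * ‖T j‖) * ((2 * n) ^ j * M) := by
          rw [ENNReal.ofReal_mul (abs_nonneg _), mul_assoc]
      _ ≤ ENNReal.ofReal (K j * decay (n + j) ζ w) * ((2 * n) ^ j * M) := by gcongr
      _ = (K j * (2 * n) ^ j) * (ENNReal.ofReal (decay (n + j) ζ w) * M) := by
          rw [ENNReal.ofReal_mul (K j).coe_nonneg, ENNReal.ofReal_coe_nnreal]; ring
      _ ≤ _ := by gcongr
  have hrem : ‖∫ y in Metric.closedBall c ε,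
      (dilate Ψ ζ (w + (c - y)) - P y) * periodicExt f y‖ₑ ≤
      K₂ * (ENNReal.ofReal (decay (n + (N + 1)) ζ w) *
            (ENNReal.ofReal (ε ^ (n + (N + 1))) * eLpNorm f ∞ volume)) := by
    set b := K (N + 1) * 2 ^ (n + (N + 1) + 1) * decay (n + (N + 1)) ζ w * ε ^ (N + 1) with hb
    refine (enorm_integral_le_lintegral_enorm _).trans ?_
    calc _ ≤ ∫⁻ y in Metric.closedBall c ε, ENNReal.ofReal b * eLpNorm f ∞ volume := by
          refine lintegral_mono_ae ?_
          filter_upwards [ae_restrict_of_ae (ae_enorm_periodicExt_le f),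
            ae_restrict_mem measurableSet_closedBall] with y hy hyB
          rw [enorm_mul]
          gcongr
          rw [← ofReal_norm]
          refine ENNReal.ofReal_le_ofReal ?_
          refine norm_dilate_sub_taylor_le Ψ (hK (N + 1)) hζ hw ?_
          rwa [← dist_eq_norm, dist_comm]
      _ = ENNReal.ofReal b * eLpNorm f ∞ volume * (ENNReal.ofReal (ε ^ n) * V) := by
          rw [setLIntegral_const, Measure.addHaar_closedBall _ _ hε.le, finrank_euclideanSpace_fin]
      _ = _ := by
          have hd := decay_nonneg (n + (N + 1)) hζ w
          rw [hb, hK₂, ENNReal.ofReal_mul (by positivity), ENNReal.ofReal_mul (by positivity),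
            ENNReal.ofReal_mul (by positivity), ENNReal.ofReal_coe_nnreal, pow_add ε n (N + 1),
            ENNReal.ofReal_mul (by positivity)]
          push_cast
          rw [ENNReal.coe_toNNReal hVt, ENNReal.ofReal_pow (by norm_num), ENNReal.ofReal_ofNat]
          ring
  calc _ ≤ _ := (enorm_add_le _ _).trans (add_le_add hmain hrem)
    _ ≤ _ := by
      push_cast
      rw [mul_add]
      gcongr
      · exact le_self_add
      · exact le_add_self

/-! ### Pointwise bounds for the maximal function -/

theorem conv_toTorus_eq_integral (Φ : EuclideanSpace ℝ (Fin n) → 𝕜) (f : UnitAddTorus (Fin n) → 𝕜)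
    (x : EuclideanSpace ℝ (Fin n)) :
    conv Φ f (toTorus x) = ∫ y, Φ (x - y) * periodicExt f y := by
  rw [← integral_sub_left_eq_self _ volume x]
  simp [conv, periodicExt, toTorus_sub]

theorem lintegral_enorm_dilate {Φ : EuclideanSpace ℝ (Fin n) → 𝕜} (hΦ : Continuous Φ) {ζ : ℝ}
    (hζ : 0 < ζ) : ∫⁻ y, ‖dilate Φ ζ y‖ₑ = ∫⁻ y, ‖Φ y‖ₑ := by
  have h : ∀ y, ‖dilate Φ ζ y‖ₑ = ENNReal.ofReal ((ζ ^ n)⁻¹) * ‖Φ (ζ⁻¹ • y)‖ₑ := fun y => by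
    rw [dilate, enorm_smul, ← ofReal_norm, Real.norm_of_nonneg (by positivity)]
  simp_rw [h]
  have hm : Measurable fun y => ‖Φ y‖ₑ := hΦ.enorm.measurable
  have hm' : Measurable fun y => ‖Φ (ζ⁻¹ • y)‖ₑ := hm.comp (measurable_const_smul _)
  rw [lintegral_const_mul _ hm', lintegral_comp_inv_smul hm hζ, ← mul_assoc,
    ← ENNReal.ofReal_mul (by positivity), inv_mul_cancel₀ (by positivity), ENNReal.ofReal_one,
    one_mul]

/-- The maximal function is bounded by the supremum norm. -/
theorem maximalFunction_le (Ψ : SchwartzMap (EuclideanSpace ℝ (Fin n)) 𝕜)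
    (f : UnitAddTorus (Fin n) → 𝕜) (x : EuclideanSpace ℝ (Fin n)) :
    maximalFunction Ψ f (toTorus x) ≤ (∫⁻ y, ‖Ψ y‖ₑ) * eLpNorm f ∞ volume := by
  refine iSup₂_le fun ζ hζ => ?_
  rw [conv_toTorus_eq_integral]
  have hm : Measurable fun y => ‖dilate Ψ ζ y‖ₑ := by
    unfold dilate
    exact ((Ψ.continuous.comp (continuous_const_smul _)).const_smul _).enorm.measurable
  calc _ ≤ ∫⁻ y, ‖dilate Ψ ζ (x - y) * periodicExt f y‖ₑ := enorm_integral_le_lintegral_enorm _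
    _ ≤ ∫⁻ y, ‖dilate Ψ ζ (x - y)‖ₑ * eLpNorm f ∞ volume := by
      refine lintegral_mono_ae ((ae_enorm_periodicExt_le f).mono fun y hy => ?_)
      rw [enorm_mul]
      gcongr
    _ = _ := by
      have hm' : Measurable fun y => ‖dilate Ψ ζ (x - y)‖ₑ :=
        hm.comp (measurable_const.sub measurable_id)
      rw [lintegral_mul_const _ hm', lintegral_sub_left_eq_self (fun y => ‖dilate Ψ ζ y‖ₑ) x,
        lintegral_enorm_dilate Ψ.continuous hζ]

theorem integrable_dilate_mul_periodicExt (Ψ : SchwartzMap (EuclideanSpace ℝ (Fin n)) 𝕜)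
    {f : UnitAddTorus (Fin n) → 𝕜} (hf : MemLp f ∞ volume) {ζ : ℝ} (hζ : 0 < ζ)
    (x : EuclideanSpace ℝ (Fin n)) :
    Integrable fun y => dilate Ψ ζ (x - y) * periodicExt f y := by
  refine Integrable.mul_bdd (c := (eLpNorm f ∞ volume).toReal) ?_
    (aestronglyMeasurable_periodicExt hf.1) ?_
  · unfold dilate
    have h := (Ψ.integrable (μ := volume)).comp_smul (inv_ne_zero hζ.ne')
    exact (h.comp_sub_left x).smul (ζ ^ n)⁻¹
  · refine (ae_enorm_periodicExt_le f).mono fun x hx => ?_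
    rw [← toReal_enorm]
    exact ENNReal.toReal_mono hf.2.ne hx

theorem image_add_latticeVec_closedBall (c : EuclideanSpace ℝ (Fin n)) (r : ℝ)
    (k : Fin n → ℤ) :
    (· + latticeVec k) '' Metric.closedBall c r = Metric.closedBall (c + latticeVec k) r := by
  ext x
  simp only [Set.mem_image, Metric.mem_closedBall]
  constructor
  · rintro ⟨y, hy, rfl⟩
    rwa [dist_add_right]
  · intro hx
    refine ⟨x - latticeVec k, ?_, sub_add_cancel _ _⟩
    rwa [← dist_add_right _ _ (latticeVec k), sub_add_cancel]

/-- The radius being below 1/2 makes the lattice copies of the ball disjoint; by periodicity each is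
translated back to `c`, moving k into the argument of the kernel. -/
theorem enorm_conv_dilate_le_tsum (Ψ : SchwartzMap (EuclideanSpace ℝ (Fin n)) 𝕜)
    {f : UnitAddTorus (Fin n) → 𝕜} (hf : MemLp f ∞ volume) {c : EuclideanSpace ℝ (Fin n)} {ε : ℝ}
    (hε : ε < 1 / 2) (hB : IsRepresentativeBall f c ε) {ζ : ℝ} (hζ : 0 < ζ)
    (x : EuclideanSpace ℝ (Fin n)) :
    ‖conv (dilate Ψ ζ) f (toTorus x)‖ₑ ≤ ∑' k : Fin n → ℤ,
      ‖∫ y in Metric.closedBall c ε,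
        dilate Ψ ζ ((x - c - latticeVec k) + (c - y)) * periodicExt f y‖ₑ := by
  have hzero : ∀ᵐ y, y ∉ ⋃ k : Fin n → ℤ, Metric.closedBall (c + latticeVec k) ε →
      dilate Ψ ζ (x - y) * periodicExt f y = 0 := by
    refine (quasiMeasurePreserving_toTorus.ae hB.ae_eq_zero).mono fun y hy hyB => ?_
    rw [periodicExt, hy, mul_zero]
    intro h
    refine hyB ?_
    have : y ∈ toTorus ⁻¹' (toTorus '' Metric.closedBall c ε) := h
    rw [preimage_toTorus_image] at this
    simpa only [image_add_latticeVec_closedBall] using this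
  rw [conv_toTorus_eq_integral, ← setIntegral_eq_integral_of_ae_compl_eq_zero hzero,
    integral_iUnion (fun _ => measurableSet_closedBall)
      (pairwise_disjoint_closedBall_latticeVec c hε)
      (integrable_dilate_mul_periodicExt Ψ hf hζ x).integrableOn]
  refine enorm_tsum_le_tsum_enorm.trans (ENNReal.tsum_le_tsum fun k => le_of_eq ?_)
  congr 1
  have h := (measurePreserving_add_right (volume : Measure (EuclideanSpace ℝ (Fin n)))
    (latticeVec k)).setIntegral_preimage_emb (measurableEmbedding_addRight _)
    (fun y => dilate Ψ ζ (x - y) * periodicExt f y) (Metric.closedBall (c + latticeVec k) ε)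
  have hpre : (· + latticeVec k) ⁻¹' Metric.closedBall (c + latticeVec k) ε =
      Metric.closedBall c ε := by
    ext y; simp
  rw [← h, hpre]
  refine integral_congr_ae (ae_of_all _ fun y => ?_)
  simp only [periodicExt, toTorus_add_latticeVec]
  congr 2
  abel

/-- Decay of the maximal function away from the supporting ball. -/
theorem exists_maximalFunction_le (Ψ : SchwartzMap (EuclideanSpace ℝ (Fin n)) 𝕜) (N : ℕ) :
    ∃ A : ℝ≥0, ∀ f : UnitAddTorus (Fin n) → 𝕜, MemLp f ∞ volume →
      ∀ (c : EuclideanSpace ℝ (Fin n)) (ε : ℝ), 0 < ε → ε < 1 / 2 → IsRepresentativeBall f c ε →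
      ∀ M : ℝ≥0∞, (∀ α : Fin n → ℕ, ∑ i, α i ≤ N → ‖moment f c ε α‖ₑ ≤ M) →
      ∀ x : EuclideanSpace ℝ (Fin n), (∀ i, |(x - c) i| ≤ 1 / 2) → 2 * ε ≤ ‖x - c‖ →
        maximalFunction Ψ f (toTorus x) ≤
          A * (ENNReal.ofReal ((‖x - c‖ ^ (n + N))⁻¹) * M +
            ENNReal.ofReal ((‖x - c‖ ^ (n + (N + 1)))⁻¹) *
              (ENNReal.ofReal (ε ^ (n + (N + 1))) * eLpNorm f ∞ volume)) := by
  obtain ⟨K, hK⟩ := exists_enorm_integral_ball_le Ψ N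
  choose C hC using fun j => exists_tsum_decay_le_inv_norm_pow (n := n) (m := n + j) (by omega)
  -- The factors n^(N-j) raise every ‖z‖^(-(n+j)) with j ≤ N to the worst power ‖z‖^(-(n+N)), using
  -- ‖z‖ ≤ n.
  set C₁ : ℝ≥0 := ∑ j ∈ Finset.range (N + 1), C j * n ^ (N - j) with hC₁
  refine ⟨K * (C₁ + C (N + 1)), fun f hf c ε hε hε2 hB M hM x hx hxε => iSup₂_le fun ζ hζ => ?_⟩
  have hz : 0 < ‖x - c‖ := by linarith
  have hz0 : x - c ≠ 0 := norm_pos_iff.1 hz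
  set F := ENNReal.ofReal (ε ^ (n + (N + 1))) * eLpNorm f ∞ volume
  have hc : ∀ i, |c i| ≤ 1 := fun i => (hB.abs_apply_le i).trans (by norm_num)
  have hterm := fun k : Fin n → ℤ => hK f hf c hc ε hε M hM ζ hζ (x - c - latticeVec k)
    (hxε.trans (norm_le_norm_sub_latticeVec hx k))
  have hsum : ∑ j ∈ Finset.range (N + 1), ∑' k : Fin n → ℤ,
      ENNReal.ofReal (decay (n + j) ζ (x - c - latticeVec k)) ≤
      C₁ * ENNReal.ofReal ((‖x - c‖ ^ (n + N))⁻¹) := by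
    rw [hC₁]
    push_cast
    rw [Finset.sum_mul]
    refine Finset.sum_le_sum fun j hj => (hC j ζ hζ _ hz0 hx).trans ?_
    rw [mul_assoc]
    gcongr
    rw [← ENNReal.ofReal_natCast, ← ENNReal.ofReal_pow (by positivity),
      ← ENNReal.ofReal_mul (by positivity)]
    refine ENNReal.ofReal_le_ofReal ?_
    have hjN : n + N = (n + j) + (N - j) := by simp at hj; omega
    have hn : ‖x - c‖ ≤ n := norm_le_of_abs_apply_le hx
    rw [← div_eq_mul_inv, le_div_iff₀ (by positivity), hjN, pow_add _ (n + j), ← mul_assoc,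
      inv_mul_cancel₀ (by positivity), one_mul]
    gcongr
  calc _ ≤ _ := enorm_conv_dilate_le_tsum Ψ hf hε2 hB hζ x
    _ ≤ _ := ENNReal.tsum_le_tsum hterm
    _ = K * ((∑ j ∈ Finset.range (N + 1), ∑' k : Fin n → ℤ,
          ENNReal.ofReal (decay (n + j) ζ (x - c - latticeVec k))) * M +
        (∑' k : Fin n → ℤ, ENNReal.ofReal (decay (n + (N + 1)) ζ (x - c - latticeVec k))) * F) := by
      rw [ENNReal.tsum_mul_left, ENNReal.tsum_add, ENNReal.tsum_mul_right, ENNReal.tsum_mul_right,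
        Summable.tsum_finsetSum fun _ _ => ENNReal.summable]
    _ ≤ K * (C₁ * ENNReal.ofReal ((‖x - c‖ ^ (n + N))⁻¹) * M +
        C (N + 1) * ENNReal.ofReal ((‖x - c‖ ^ (n + (N + 1)))⁻¹) * F) := by
      gcongr
      exact hC (N + 1) ζ hζ _ hz0 hx
    _ ≤ K * ((C₁ + C (N + 1)) * ENNReal.ofReal ((‖x - c‖ ^ (n + N))⁻¹) * M +
        (C₁ + C (N + 1)) * ENNReal.ofReal ((‖x - c‖ ^ (n + (N + 1)))⁻¹) * F) := by
      gcongr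
      · exact le_self_add
      · exact le_add_self
    _ = _ := by push_cast; ring

/-! ### Integrals of powers of the norm -/

theorem lintegral_shell_le {r : ℝ} (hr : 0 < r) :
    ∫⁻ x in {x : EuclideanSpace ℝ (Fin n) | r ≤ ‖x‖ ∧ ‖x‖ ≤ 2 * r},
      ENNReal.ofReal ((‖x‖ ^ n)⁻¹) ≤
    2 ^ n * volume (Metric.ball (0 : EuclideanSpace ℝ (Fin n)) 1) := by
  have hm : MeasurableSet {x : EuclideanSpace ℝ (Fin n) | r ≤ ‖x‖ ∧ ‖x‖ ≤ 2 * r} :=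
    (measurableSet_le measurable_const measurable_norm).inter
      (measurableSet_le measurable_norm measurable_const)
  calc _ ≤ ∫⁻ x in {x : EuclideanSpace ℝ (Fin n) | r ≤ ‖x‖ ∧ ‖x‖ ≤ 2 * r},
        ENNReal.ofReal ((r ^ n)⁻¹) := by
        refine setLIntegral_mono' hm fun x hx => ENNReal.ofReal_le_ofReal ?_
        have := hx.1
        gcongr
    _ ≤ ENNReal.ofReal ((r ^ n)⁻¹) *
        volume (Metric.closedBall (0 : EuclideanSpace ℝ (Fin n)) (2 * r)) := by
        rw [setLIntegral_const]
        gcongr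
        intro x hx
        simpa using hx.2
    _ = _ := by
        rw [Measure.addHaar_closedBall _ _ (by positivity), finrank_euclideanSpace_fin, ← mul_assoc,
          ← ENNReal.ofReal_mul (by positivity), mul_pow, mul_comm (2 ^ n), ← mul_assoc,
          inv_mul_cancel₀ (by positivity), one_mul, ENNReal.ofReal_pow (by norm_num),
          ENNReal.ofReal_ofNat]

/-- Each dyadic shell contributes a bounded amount, and O(|log ε|) of them cover the region. -/
theorem exists_lintegral_inv_norm_pow_le_log (n : ℕ) (R : ℝ) : ∃ C : ℝ≥0, ∀ ε : ℝ, 0 < ε →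
    ε < 1 / 2 → ∫⁻ x in {x : EuclideanSpace ℝ (Fin n) | 2 * ε ≤ ‖x‖ ∧ ‖x‖ ≤ R},
      ENNReal.ofReal ((‖x‖ ^ n)⁻¹) ≤ C * ENNReal.ofReal |Real.log ε| := by
  set V := volume (Metric.ball (0 : EuclideanSpace ℝ (Fin n)) 1) with hV
  have hVt : V ≠ ∞ := measure_ball_lt_top.ne
  have hL : 0 < Real.log 2 := Real.log_pos one_lt_two
  have hR : 0 ≤ Real.log (|R| + 1) := Real.log_nonneg (by linarith [abs_nonneg R])
  -- Chosen so that the number of shells is at most a |log ε|: additive constants are absorbed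
  -- through log 2 ≤ |log ε|, valid because ε < 1/2.
  set a : ℝ := Real.log (|R| + 1) / Real.log 2 / Real.log 2 + 2 / Real.log 2 with ha
  refine ⟨a.toNNReal * (2 ^ n * V.toNNReal), fun ε hε hε2 => ?_⟩
  have hlog : Real.log 2 ≤ |Real.log ε| := by
    rw [abs_of_neg (Real.log_neg hε (by linarith)), ← Real.log_inv]
    refine Real.log_le_log two_pos ?_
    rw [le_inv_comm₀ two_pos hε]
    linarith
  have hlogε : Real.log ε = -|Real.log ε| := by
    rw [abs_of_neg (Real.log_neg hε (by linarith)), neg_neg]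
  set m := ⌊Real.log ((|R| + 1) / ε) / Real.log 2⌋₊ with hm
  have hR' : 0 < |R| + 1 := by positivity
  have hmle : ((m + 1 : ℕ) : ℝ) ≤ a * |Real.log ε| := by
    have hd : Real.log ((|R| + 1) / ε) = Real.log (|R| + 1) + |Real.log ε| := by
      rw [Real.log_div hR'.ne' hε.ne', hlogε]; simp
    have h1 : (m : ℝ) ≤ (Real.log (|R| + 1) + |Real.log ε|) / Real.log 2 := by
      rw [hm, hd]
      exact Nat.floor_le (by positivity)
    have h2 : 1 ≤ |Real.log ε| / Real.log 2 := (one_le_div hL).2 hlog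
    have h3 : Real.log (|R| + 1) / Real.log 2 * 1 ≤
        Real.log (|R| + 1) / Real.log 2 * (|Real.log ε| / Real.log 2) := by gcongr
    calc ((m + 1 : ℕ) : ℝ) ≤ (Real.log (|R| + 1) + |Real.log ε|) / Real.log 2 +
          |Real.log ε| / Real.log 2 := by push_cast; linarith
      _ = Real.log (|R| + 1) / Real.log 2 * 1 + 2 * (|Real.log ε| / Real.log 2) := by ring
      _ ≤ Real.log (|R| + 1) / Real.log 2 * (|Real.log ε| / Real.log 2) +
          2 * (|Real.log ε| / Real.log 2) := by gcongr
      _ = _ := by rw [ha]; ring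
  have hcover : {x : EuclideanSpace ℝ (Fin n) | 2 * ε ≤ ‖x‖ ∧ ‖x‖ ≤ R} ⊆
      ⋃ i : Fin (m + 1), {x | 2 ^ (i : ℕ) * (2 * ε) ≤ ‖x‖ ∧
        ‖x‖ ≤ 2 * (2 ^ (i : ℕ) * (2 * ε))} := by
    rintro x ⟨hx1, hx2⟩
    obtain ⟨i, hi1, hi2⟩ := exists_nat_pow_near (x := ‖x‖ / (2 * ε)) (y := (2 : ℝ))
      ((one_le_div (by positivity)).2 hx1) one_lt_two
    rw [le_div_iff₀ (by positivity)] at hi1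
    rw [div_lt_iff₀ (by positivity), pow_succ] at hi2
    have him : i ≤ m := by
      refine Nat.le_floor ?_
      rw [le_div_iff₀ hL, ← Real.log_pow]
      refine Real.log_le_log (by positivity) ?_
      rw [le_div_iff₀ hε]
      have h1 : 0 < (2 : ℝ) ^ i * ε := by positivity
      linarith [le_abs_self R]
    refine Set.mem_iUnion.2 ⟨⟨i, by omega⟩, hi1, ?_⟩
    show ‖x‖ ≤ 2 * (2 ^ i * (2 * ε))
    linarith
  calc _ ≤ ∫⁻ x in ⋃ i : Fin (m + 1), {x : EuclideanSpace ℝ (Fin n) |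
          2 ^ (i : ℕ) * (2 * ε) ≤ ‖x‖ ∧ ‖x‖ ≤ 2 * (2 ^ (i : ℕ) * (2 * ε))},
          ENNReal.ofReal ((‖x‖ ^ n)⁻¹) := lintegral_mono_set hcover
    _ ≤ ∑' _i : Fin (m + 1), 2 ^ n * V :=
        (lintegral_iUnion_le _ _).trans
          (ENNReal.tsum_le_tsum fun i => lintegral_shell_le (by positivity))
    _ = ENNReal.ofReal ((m + 1 : ℕ) : ℝ) * (2 ^ n * V) := by
        rw [tsum_fintype, Finset.sum_const, Finset.card_univ, Fintype.card_fin, nsmul_eq_mul,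
          ENNReal.ofReal_natCast]
    _ ≤ ENNReal.ofReal (a * |Real.log ε|) * (2 ^ n * V) := by gcongr
    _ = _ := by
        rw [ENNReal.ofReal_mul (by positivity)]
        push_cast
        rw [ENNReal.coe_toNNReal hVt, ENNReal.ofReal]
        ring

/-- On this region ‖x‖ ≥ (ε + ‖x‖)/2, so the integrand is dominated by a rescaling of (1 +
‖y‖)^(-s), integrable since s > n. -/
theorem exists_lintegral_norm_rpow_neg_le (n : ℕ) {s : ℝ} (hs : n < s) : ∃ C : ℝ≥0, ∀ ε : ℝ,
    0 < ε → ∫⁻ x in {x : EuclideanSpace ℝ (Fin n) | 2 * ε ≤ ‖x‖}, ENNReal.ofReal (‖x‖ ^ (-s)) ≤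
      C * ENNReal.ofReal (ε ^ (n - s)) := by
  have hs0 : 0 < s := lt_of_le_of_lt n.cast_nonneg hs
  set I := ∫⁻ x : EuclideanSpace ℝ (Fin n), ENNReal.ofReal ((1 + ‖x‖) ^ (-s)) with hI
  have hIt : I ≠ ∞ := (finite_integral_one_add_norm (by simpa using hs)).ne
  refine ⟨((2 : ℝ) ^ s).toNNReal * I.toNNReal, fun ε hε => ?_⟩
  have hm : MeasurableSet {x : EuclideanSpace ℝ (Fin n) | 2 * ε ≤ ‖x‖} :=
    measurableSet_le measurable_const measurable_norm
  have hmeas : Measurable fun x : EuclideanSpace ℝ (Fin n) =>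
      ENNReal.ofReal ((1 + ‖x‖) ^ (-s)) := by fun_prop
  have hmeas' : Measurable fun x : EuclideanSpace ℝ (Fin n) =>
      ENNReal.ofReal ((1 + ‖ε⁻¹ • x‖) ^ (-s)) := by fun_prop
  calc _ ≤ ∫⁻ x in {x : EuclideanSpace ℝ (Fin n) | 2 * ε ≤ ‖x‖},
        ENNReal.ofReal (ε ^ (-s) * 2 ^ s) * ENNReal.ofReal ((1 + ‖ε⁻¹ • x‖) ^ (-s)) := by
        refine setLIntegral_mono' hm fun x hx => ?_
        rw [← ENNReal.ofReal_mul (by positivity)]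
        refine ENNReal.ofReal_le_ofReal ?_
        have hx' : 2 * ε ≤ ‖x‖ := hx
        have h1 : ‖ε⁻¹ • x‖ = ‖x‖ / ε := by
          rw [norm_smul, Real.norm_of_nonneg (by positivity), div_eq_inv_mul]
        have h2 : (2 : ℝ) ^ s = ((2 : ℝ)⁻¹) ^ (-s) := by
          rw [Real.inv_rpow two_pos.le, Real.rpow_neg two_pos.le, inv_inv]
        rw [h1, h2, ← Real.mul_rpow (by positivity) (by positivity),
          ← Real.mul_rpow (by positivity) (by positivity)]
        refine Real.rpow_le_rpow_of_nonpos (by positivity) ?_ (by linarith)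
        have : ε * 2⁻¹ * (1 + ‖x‖ / ε) = (ε + ‖x‖) / 2 := by field_simp
        rw [this]
        linarith
    _ ≤ ∫⁻ x : EuclideanSpace ℝ (Fin n),
        ENNReal.ofReal (ε ^ (-s) * 2 ^ s) * ENNReal.ofReal ((1 + ‖ε⁻¹ • x‖) ^ (-s)) :=
        setLIntegral_le_lintegral _ _
    _ = _ := by
        rw [lintegral_const_mul _ hmeas', lintegral_comp_inv_smul hmeas hε, ← hI, sub_eq_add_neg,
          Real.rpow_add hε, Real.rpow_natCast, ENNReal.ofReal_mul (by positivity),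
          ENNReal.ofReal_mul (by positivity)]
        push_cast
        rw [ENNReal.coe_toNNReal hIt, ENNReal.ofReal.eq_def (2 ^ s)]
        ring

theorem setLIntegral_comp_sub_le {s t : Set (EuclideanSpace ℝ (Fin n))}
    {c : EuclideanSpace ℝ (Fin n)} (h : ∀ x ∈ s, x - c ∈ t)
    (g : EuclideanSpace ℝ (Fin n) → ℝ≥0∞) : ∫⁻ x in s, g (x - c) ≤ ∫⁻ x in t, g x := by
  refine (lintegral_mono_set (t := (· - c) ⁻¹' t) h).trans (le_of_eq ?_)
  exact (measurePreserving_sub_right volume c).setLIntegral_comp_preimage_emb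
    (measurableEmbedding_subRight c) g t

theorem measurableSet_cube (a : EuclideanSpace ℝ (Fin n)) : MeasurableSet (cube a) := by
  have : cube a = ⋂ i, (fun x : EuclideanSpace ℝ (Fin n) => x i) ⁻¹' Set.Ioc (a i) (a i + 1) := by
    ext x; simp [cube]
  rw [this]
  exact MeasurableSet.iInter fun i => (by fun_prop : Measurable fun x : EuclideanSpace ℝ (Fin n) =>
    x i) measurableSet_Ioc

theorem hardyNorm_rpow {p : ℝ} (hp : 0 < p) (Ψ : SchwartzMap (EuclideanSpace ℝ (Fin n)) 𝕜)
    (f : UnitAddTorus (Fin n) → 𝕜) :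
    hardyNorm p Ψ f ^ p = ∫⁻ x, maximalFunction Ψ f x ^ p := by
  rw [hardyNorm, eLpNorm_eq_lintegral_rpow_enorm_toReal (by simpa using hp) ENNReal.ofReal_ne_top,
    ENNReal.toReal_ofReal hp.le, ← ENNReal.rpow_mul, one_div, inv_mul_cancel₀ hp.ne',
    ENNReal.rpow_one]
  simp

theorem ofReal_inv_pow_rpow {t p : ℝ} (ht : 0 < t) (hp : 0 ≤ p) (m : ℕ) :
    ENNReal.ofReal ((t ^ m)⁻¹) ^ p = ENNReal.ofReal (t ^ (-(m * p))) := by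
  rw [ENNReal.ofReal_rpow_of_nonneg (by positivity) hp, Real.inv_rpow (by positivity),
    ← Real.rpow_natCast, ← Real.rpow_mul ht.le, Real.rpow_neg ht.le]

/-- Reduces every exponent q ≤ n to the critical one, so that a single logarithmic bound covers all
p; for q < n this gives away the logarithm. -/
theorem rpow_neg_le_mul_inv_pow {t R q : ℝ} (ht : 0 < t) (htR : t ≤ R) (hq : q ≤ n) :
    t ^ (-q) ≤ R ^ (n - q) * (t ^ n)⁻¹ := by
  have h : t ^ (-q) = t ^ (n - q) * (t ^ n)⁻¹ := by
    rw [← Real.rpow_natCast, ← Real.rpow_neg ht.le, ← Real.rpow_add ht]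
    congr 1; ring
  rw [h]
  gcongr

/-- The integral, over a spherical shell, of the pointwise majorant of the maximal
function away from the supporting ball. -/
theorem exists_lintegral_majorant_le (n : ℕ) {p : ℝ} (hp0 : 0 < p) (hp1 : p ≤ 1) {N : ℕ}
    (hN : (n + N) * p ≤ n) (hN' : n < (n + (N + 1)) * p) (R : ℝ) :
    ∃ C : ℝ≥0, ∀ ε : ℝ, 0 < ε → ε < 1 / 2 → ∀ M F : ℝ≥0∞,
      ∫⁻ z in {z : EuclideanSpace ℝ (Fin n) | 2 * ε ≤ ‖z‖ ∧ ‖z‖ ≤ R},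
        (ENNReal.ofReal ((‖z‖ ^ (n + N))⁻¹) * M + ENNReal.ofReal ((‖z‖ ^ (n + (N + 1)))⁻¹) *
          (ENNReal.ofReal (ε ^ (n + (N + 1))) * F)) ^ p ≤
      C * (ENNReal.ofReal (ε ^ n) * F ^ p + ENNReal.ofReal |Real.log ε| * M ^ p) := by
  obtain ⟨C₁, hC₁⟩ := exists_lintegral_inv_norm_pow_le_log n R
  obtain ⟨C₂, hC₂⟩ := exists_lintegral_norm_rpow_neg_le n (s := (n + (N + 1)) * p) hN'
  set D : ℝ := |R| ^ (n - (n + N) * p) with hD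
  refine ⟨D.toNNReal * C₁ + C₂, fun ε hε hε2 M F => ?_⟩
  set S := {z : EuclideanSpace ℝ (Fin n) | 2 * ε ≤ ‖z‖ ∧ ‖z‖ ≤ R} with hS
  have hSm : MeasurableSet S := (measurableSet_le measurable_const measurable_norm).inter
    (measurableSet_le measurable_norm measurable_const)
  set s : ℝ := (n + (N + 1)) * p with hs
  have hpoint : ∀ z ∈ S, (ENNReal.ofReal ((‖z‖ ^ (n + N))⁻¹) * M +
      ENNReal.ofReal ((‖z‖ ^ (n + (N + 1)))⁻¹) * (ENNReal.ofReal (ε ^ (n + (N + 1))) * F)) ^ p ≤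
      ENNReal.ofReal ((‖z‖ ^ n)⁻¹) * (ENNReal.ofReal D * M ^ p) +
        ENNReal.ofReal (‖z‖ ^ (-s)) * (ENNReal.ofReal (ε ^ s) * F ^ p) := by
    intro z hz
    have hz0 : 0 < ‖z‖ := by linarith [hz.1]
    -- Subadditivity of t ↦ t^p, where p ≤ 1 enters.
    refine (ENNReal.rpow_add_le_add_rpow _ _ hp0.le hp1).trans ?_
    rw [ENNReal.mul_rpow_of_nonneg _ _ hp0.le, ENNReal.mul_rpow_of_nonneg _ _ hp0.le,
      ENNReal.mul_rpow_of_nonneg _ _ hp0.le, ofReal_inv_pow_rpow hz0 hp0.le,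
      ofReal_inv_pow_rpow hz0 hp0.le, ENNReal.ofReal_rpow_of_nonneg (by positivity) hp0.le,
      ← Real.rpow_natCast ε, ← Real.rpow_mul hε.le]
    push_cast
    rw [← hs, ← mul_assoc (ENNReal.ofReal ((‖z‖ ^ n)⁻¹)), ← ENNReal.ofReal_mul (by positivity)]
    gcongr
    rw [mul_comm _ D, hD]
    exact rpow_neg_le_mul_inv_pow hz0 (hz.2.trans (le_abs_self R)) hN
  have hm : Measurable fun z : EuclideanSpace ℝ (Fin n) => ENNReal.ofReal ((‖z‖ ^ n)⁻¹) := by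
    fun_prop
  have hm' : Measurable fun z : EuclideanSpace ℝ (Fin n) => ENNReal.ofReal (‖z‖ ^ (-s)) := by
    fun_prop
  calc _ ≤ ∫⁻ z in S, (ENNReal.ofReal ((‖z‖ ^ n)⁻¹) * (ENNReal.ofReal D * M ^ p) +
        ENNReal.ofReal (‖z‖ ^ (-s)) * (ENNReal.ofReal (ε ^ s) * F ^ p)) :=
        setLIntegral_mono' hSm hpoint
    _ = (∫⁻ z in S, ENNReal.ofReal ((‖z‖ ^ n)⁻¹)) * (ENNReal.ofReal D * M ^ p) +
        (∫⁻ z in S, ENNReal.ofReal (‖z‖ ^ (-s))) * (ENNReal.ofReal (ε ^ s) * F ^ p) := by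
        rw [lintegral_add_left (hm.mul_const _), lintegral_mul_const _ hm,
          lintegral_mul_const _ hm']
    _ ≤ (C₁ * ENNReal.ofReal |Real.log ε|) * (ENNReal.ofReal D * M ^ p) +
        (C₂ * ENNReal.ofReal (ε ^ (n - s))) * (ENNReal.ofReal (ε ^ s) * F ^ p) := by
        gcongr
        · exact hC₁ ε hε hε2
        · exact (lintegral_mono_set fun z hz => hz.1).trans (hC₂ ε hε)
    _ = (D.toNNReal * C₁ : ℝ≥0) * (ENNReal.ofReal |Real.log ε| * M ^ p) +
        C₂ * (ENNReal.ofReal (ε ^ n) * F ^ p) := by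
        have h : ENNReal.ofReal (ε ^ n) = ENNReal.ofReal (ε ^ (n - s)) * ENNReal.ofReal (ε ^ s) := by
          rw [← ENNReal.ofReal_mul (by positivity), ← Real.rpow_add hε, sub_add_cancel,
            Real.rpow_natCast]
        rw [h, ENNReal.coe_mul, ENNReal.ofReal.eq_def D]
        ring
    _ ≤ (D.toNNReal * C₁ + C₂ : ℝ≥0) * (ENNReal.ofReal |Real.log ε| * M ^ p) +
        (D.toNNReal * C₁ + C₂ : ℝ≥0) * (ENNReal.ofReal (ε ^ n) * F ^ p) := by
        gcongr
        · exact le_self_add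
        · exact le_add_self
    _ = _ := by rw [mul_add, add_comm]

end TorusHardy

end

/-! ### Assembly of the near and far estimates -/

open TorusHardy in
theorem propositionA8 {𝕜 : Type*} [RCLike 𝕜] (n : ℕ) (p : ℝ) (hp0 : 0 < p) (hp1 : p ≤ 1)
    (Ψ : SchwartzMap (EuclideanSpace ℝ (Fin n)) 𝕜) :
    ∃ C : ℝ≥0, ∀ f : UnitAddTorus (Fin n) → 𝕜, MemLp f ∞ volume →
      ∀ (c : EuclideanSpace ℝ (Fin n)) (ε : ℝ), 0 < ε → ε < 1 / 2 →
        TorusHardy.IsRepresentativeBall f c ε →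
        TorusHardy.hardyNorm p Ψ f ^ p ≤
          C * (ENNReal.ofReal (ε ^ n) * eLpNorm f ∞ volume ^ p +
            ENNReal.ofReal |Real.log ε| *
              ⨆ (α : Fin n → ℕ) (_ : ∑ i, α i ≤ ⌊(n : ℝ) * (1 / p - 1)⌋₊),
                ‖TorusHardy.moment f c ε α‖ₑ ^ p) := by
  set N := ⌊(n : ℝ) * (1 / p - 1)⌋₊ with hNdef
  have hp1' : 1 ≤ 1 / p := (one_le_div hp0).2 hp1
  have hmul : ((n : ℝ) + n * (1 / p - 1)) * p = n := by field_simp; ring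
  have hN : ((n : ℝ) + N) * p ≤ n := by
    have : (N : ℝ) ≤ n * (1 / p - 1) :=
      Nat.floor_le (mul_nonneg n.cast_nonneg (by linarith))
    calc ((n : ℝ) + N) * p ≤ (n + n * (1 / p - 1)) * p := by gcongr
      _ = n := hmul
  have hN' : (n : ℝ) < (n + (N + 1)) * p := by
    have : (n : ℝ) * (1 / p - 1) < N + 1 := Nat.lt_floor_add_one _
    calc (n : ℝ) = (n + n * (1 / p - 1)) * p := hmul.symm
      _ < _ := by gcongr
  obtain ⟨A, hA⟩ := exists_maximalFunction_le Ψ N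
  obtain ⟨C, hC⟩ := exists_lintegral_majorant_le n hp0 hp1 hN hN' n
  set J := ∫⁻ y, ‖Ψ y‖ₑ with hJ
  have hJt : J ≠ ∞ := (Ψ.integrable (μ := volume)).2.ne
  set V := volume (Metric.ball (0 : EuclideanSpace ℝ (Fin n)) 1) with hV
  have hVt : V ≠ ∞ := measure_ball_lt_top.ne
  refine ⟨J.toNNReal ^ p * (2 ^ n * V.toNNReal) + A ^ p * C, fun f hf c ε hε hε2 hB => ?_⟩
  set S := ⨆ (α : Fin n → ℕ) (_ : ∑ i, α i ≤ N), ‖moment f c ε α‖ₑ ^ p with hS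
  set F := eLpNorm f ∞ volume with hF
  -- The p-th root turns the supremum of p-th powers into a common bound for the moments themselves.
  set M := S ^ p⁻¹ with hMdef
  have hMp : M ^ p = S := by rw [hMdef, ← ENNReal.rpow_mul, inv_mul_cancel₀ hp0.ne', ENNReal.rpow_one]
  have hM : ∀ α : Fin n → ℕ, ∑ i, α i ≤ N → ‖moment f c ε α‖ₑ ≤ M := fun α hα => by
    rw [hMdef, ENNReal.le_rpow_inv_iff hp0]
    exact le_iSup₂ (f := fun (α : Fin n → ℕ) (_ : ∑ i, α i ≤ N) => ‖moment f c ε α‖ₑ ^ p) α hα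
  set a : EuclideanSpace ℝ (Fin n) := WithLp.toLp 2 fun i => c i - 1 / 2 with ha
  set Q := cube a ∩ {x | 2 * ε ≤ ‖x - c‖} with hQ
  have hQm : MeasurableSet Q := (measurableSet_cube a).inter
    (measurableSet_le measurable_const (measurable_id.sub_const c).norm)
  have hcube : ∀ x ∈ cube a, ∀ i, |(x - c) i| ≤ 1 / 2 := fun x hx i => by
    have h := hx i
    simp only [ha, Set.mem_Ioc] at h
    rw [PiLp.sub_apply, abs_le]
    constructor <;> linarith [h.1, h.2]
  -- The ball may stick out of the cube when ε > 1/4; this is harmless, since the near bound holds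
  -- at every point.
  have hcover : cube a ⊆ Metric.closedBall c (2 * ε) ∪ Q := fun x hx => by
    rcases le_total ‖x - c‖ (2 * ε) with h | h
    · exact Or.inl (by rwa [Metric.mem_closedBall, dist_eq_norm])
    · exact Or.inr ⟨hx, h⟩
  have hnear : ∫⁻ x in Metric.closedBall c (2 * ε), maximalFunction Ψ f (toTorus x) ^ p ≤
      (J ^ p * (2 ^ n * V)) * (ENNReal.ofReal (ε ^ n) * F ^ p) := by
    calc _ ≤ ∫⁻ _x in Metric.closedBall c (2 * ε), (J * F) ^ p :=
          lintegral_mono fun x => ENNReal.rpow_le_rpow (maximalFunction_le Ψ f x) hp0.le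
      _ = _ := by
          rw [setLIntegral_const, Measure.addHaar_closedBall _ _ (by positivity),
            finrank_euclideanSpace_fin, ENNReal.mul_rpow_of_nonneg _ _ hp0.le, mul_pow,
            ENNReal.ofReal_mul (by positivity), ENNReal.ofReal_pow (by norm_num),
            ENNReal.ofReal_ofNat]
          ring
  have hfar : ∫⁻ x in Q, maximalFunction Ψ f (toTorus x) ^ p ≤
      (A ^ p * C) * (ENNReal.ofReal (ε ^ n) * F ^ p + ENNReal.ofReal |Real.log ε| * S) := by
    set g : EuclideanSpace ℝ (Fin n) → ℝ≥0∞ := fun z =>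
      (ENNReal.ofReal ((‖z‖ ^ (n + N))⁻¹) * M + ENNReal.ofReal ((‖z‖ ^ (n + (N + 1)))⁻¹) *
          (ENNReal.ofReal (ε ^ (n + (N + 1))) * F)) ^ p with hg
    have hAt : (A : ℝ≥0∞) ^ p ≠ ∞ := ENNReal.rpow_ne_top_of_nonneg hp0.le ENNReal.coe_ne_top
    calc _ ≤ ∫⁻ x in Q, (A : ℝ≥0∞) ^ p * g (x - c) := by
          refine setLIntegral_mono' hQm fun x hx => ?_
          rw [hg, ← ENNReal.mul_rpow_of_nonneg _ _ hp0.le]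
          exact ENNReal.rpow_le_rpow
            (hA f hf c ε hε hε2 hB M hM x (hcube x hx.1) hx.2) hp0.le
      _ = (A : ℝ≥0∞) ^ p * ∫⁻ x in Q, g (x - c) := lintegral_const_mul' _ _ hAt
      _ ≤ (A : ℝ≥0∞) ^ p * (C * (ENNReal.ofReal (ε ^ n) * F ^ p +
            ENNReal.ofReal |Real.log ε| * M ^ p)) := by
          gcongr
          refine (setLIntegral_comp_sub_le (fun x hx => ?_) g).trans (hC ε hε hε2 M F)
          exact ⟨hx.2, norm_le_of_abs_apply_le (hcube x hx.1)⟩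
      _ = _ := by rw [hMp, mul_assoc]
  rw [hardyNorm_rpow hp0]
  calc _ ≤ ∫⁻ x in cube a, maximalFunction Ψ f (toTorus x) ^ p :=
        lintegral_torus_le (fun x => maximalFunction Ψ f x ^ p) a
    _ ≤ _ := (lintegral_mono_set hcover).trans (lintegral_union_le _ _ _)
    _ ≤ _ := add_le_add hnear hfar
    _ ≤ (J ^ p * (2 ^ n * V)) * (ENNReal.ofReal (ε ^ n) * F ^ p +
          ENNReal.ofReal |Real.log ε| * S) +
        (A ^ p * C) * (ENNReal.ofReal (ε ^ n) * F ^ p + ENNReal.ofReal |Real.log ε| * S) := by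
        gcongr
        exact le_self_add
    _ = _ := by
        rw [← add_mul]
        push_cast
        rw [ENNReal.coe_rpow_of_nonneg _ hp0.le, ENNReal.coe_rpow_of_nonneg _ hp0.le,
          ENNReal.coe_toNNReal hJt, ENNReal.coe_toNNReal hVt]
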